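/- Let $m,n\ge 1$ be integers, $c>0$, $\nu_1,\dots,\nu_m\in(0,1)$ and $\lambda_1,\dots,\lambda_m\ge 0$ with $\Lambda:=\sum_{j=1}^m\lambda_j>0$. For $1\le j\le m$ and $i\ge 1$ let ${}_iH^{\nu_j}_j$ be stable subordinators of order $\nu_j$ (processes on $[0,\infty)$ with values in $[0,\infty)$, started at $0$, with stationary independent increments, almost surely nondecreasing and right-continuous paths, and $\mathbb E\,e^{-\mu\,{}_iH^{\nu_j}_j(s)}=e^{-s\mu^{\nu_j}}$ for $\mu,s\ge 0$). Let $\boldsymbol B_n$ be an $n$-dimensional Brownian motion with $\mathbb E\,e^{i\xi\cdot \boldsymbol B_n(s)}=e^{-s\|\xi\|^2}$. All these processes are independent. For $r\in\mathbb N$ put $$\mathfrak H_r(s)=\sum_{j=1}^m\lambda_j^{1/\nu_j^r}\;{}_1H_j^{\nu_j}\bigl({}_2H_j^{\nu_j}(\cdots\,{}_rH_j^{\nu_j}(s)\cdots)\bigr),\qquad \mathfrak L_r(t)=\inf\{s>0:\mathfrak H_r(s)\ge t\}.$$ Then there is a random vector $X_{m,n}$ in $\mathbb R^n$, not depending on $t$,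 such that for every fixed $t>0$ $$\boldsymbol B_n\bigl(c^2\,\mathfrak L_r(t)\bigr)\longrightarrow X_{m,n}\quad\text{in law as } r\to\infty .$$ The law of $X_{m,n}$ has the (nonnegative) density, with respect to Lebesgue measure, given for $x\neq 0$ by $$w(x)=\frac{1}{(2\pi)^{n/2}}\left(\frac{\sqrt{\Lambda}}{c}\right)^{\frac{n+2}{2}}\|x\|^{-\frac{n-2}{2}}K_{\frac{n-2}{2}}\!\left(\frac{\sqrt{\Lambda}}{c}\|x\|\right),$$ where $K_\nu(z)=\int_0^\infty e^{-z\cosh u}\cosh(\nu u)\,du$ $(z>0)$ is the modified Bessel function of the second kind. On $\mathbb R^n\setminus\{0\}$ the function $w$ is twice continuously differentiable and satisfies $\Lambda\,w=c^2\,\Delta w$. -/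

import Mathlib

open MeasureTheory ProbabilityTheory Filter Topology
open scoped NNReal ENNReal Laplacian

noncomputable section

/-- A stable subordinator of order `ν`: a process with values in `[0, ∞)`, started at `0`, with
independent and stationary increments, with almost surely nondecreasing right-continuous paths
(which therefore have left limits), and with `E exp (-μ H(t)) = exp (-t μ ^ ν)` for `μ ≥ 0`. -/
structure IsStableSubordinator {Ω : Type*} [MeasurableSpace Ω]
    (ν : ℝ) (H : ℝ≥0 → Ω → ℝ≥0) (P : Measure Ω) : Prop where
  measurable : ∀ t, Measurable (H t)
  start : ∀ᵐ ω ∂P, H 0 ω = 0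
  indep_increments : HasIndepIncrements (fun t ω => (H t ω : ℝ)) P
  stationary_increments : ∀ s t : ℝ≥0,
    IdentDistrib (fun ω => (H (s + t) ω : ℝ) - (H s ω : ℝ)) (fun ω => (H t ω : ℝ)) P P
  laplace : ∀ (t : ℝ≥0) (μ : ℝ), 0 ≤ μ →
    ∫ ω, Real.exp (-μ * (H t ω : ℝ)) ∂P = Real.exp (-(t : ℝ) * μ ^ ν)
  paths : ∀ᵐ ω ∂P, Monotone (fun t => H t ω) ∧
    ∀ t, ContinuousWithinAt (fun s => H s ω) (Set.Ici t) t

/-- `n`-dimensional Brownian motion with generator the Laplacian: the coordinates are independent,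
and each of them is `√2` times a standard one-dimensional Brownian motion, so that
`E exp (i ξ · B(t)) = exp (-t ‖ξ‖ ^ 2)`. -/
structure IsBrownianWithGeneratorLaplacian {Ω : Type*} [MeasurableSpace Ω] {n : ℕ}
    (B : ℝ≥0 → Ω → EuclideanSpace ℝ (Fin n)) (P : Measure Ω) : Prop where
  measurable : ∀ t, Measurable (B t)
  coord : ∀ k : Fin n, IsBrownianReal (fun t ω => B t ω k / √2) P
  indep : iIndepFun (fun (k : Fin n) ω (t : ℝ≥0) => B t ω k) P

/-- The `r`-fold composition `H₁ (H₂ (⋯ (H_r (s)) ⋯))` of the processes of a sequence (whose first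
term `H₁` has index `0` here). -/
def iteratedProcess {Ω : Type*} (H : ℕ → ℝ≥0 → Ω → ℝ≥0) : ℕ → ℝ≥0 → Ω → ℝ≥0
  | 0, s, _ => s
  | r + 1, s, ω => iteratedProcess H r (H r s ω) ω

/-- The linear combination `∑ j, λ_j ^ (1 / ν_j ^ r) * (r-fold composition of the j-th sequence)`;
its Laplace exponent is `∑ j, λ_j μ ^ (ν_j ^ r)`. -/
def combinedProcess {Ω : Type*} {m : ℕ} (lam ν : Fin m → ℝ)
    (H : Fin m → ℕ → ℝ≥0 → Ω → ℝ≥0) (r : ℕ) (s : ℝ≥0) (ω : Ω) : ℝ :=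
  ∑ j, lam j ^ (1 / ν j ^ r) * (iteratedProcess (H j) r s ω : ℝ)

/-- The first time `s > 0` at which the process `X` reaches the level `t`, that is
`inf {s > 0 : X(s) ≥ t}`. -/
def hittingLevelTime {Ω : Type*} (X : ℝ≥0 → Ω → ℝ) (t : ℝ) (ω : Ω) : ℝ≥0 :=
  sInf {s : ℝ≥0 | 0 < s ∧ t ≤ X s ω}

/-- The modified Bessel function of the second kind (Macdonald function) of real order `ν`, at a
real argument `z > 0`: `K_ν(z) = ∫_0^∞ exp (-z cosh u) cosh (ν u) du`. -/
def besselK (ν z : ℝ) : ℝ :=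
  ∫ u in Set.Ioi (0 : ℝ), Real.exp (-z * Real.cosh u) * Real.cosh (ν * u)

/-- The `n`-dimensional Gauss-Laplace density with parameters `Λ` and `c`. As usual for a density,
its value at the single point `0` is irrelevant. -/
def gaussLaplaceDensity (n : ℕ) (Λ c : ℝ) (x : EuclideanSpace ℝ (Fin n)) : ℝ :=
  (2 * Real.pi) ^ (-((n : ℝ) / 2)) * (√Λ / c) ^ (((n : ℝ) + 2) / 2)
    * ‖x‖ ^ (-(((n : ℝ) - 2) / 2)) * besselK (((n : ℝ) - 2) / 2) (√Λ / c * ‖x‖)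

end

/-! Composition raises the Laplace variable to successive powers, so the Laplace exponent of `𝔥_r`,
the combined process, is `∑ λ_j μ ^ (ν_j ^ r)`. As `ν_j ^ r → 0`, it tends to `Λ` for every `μ > 0`:
in the limit the process at time `s` is `0` with probability `exp (-Λ s)` and infinite otherwise.
Since the hitting time exceeds `s` exactly when the process at `s` is below `t`, its tail tends to
`exp (-Λ s)`, whatever `t > 0` (`tendsto_measureReal_lt_sojournTime`). The hitting time thus becomes
exponential of rate `Λ`.

Conditioning on this time, which is independent of the Brownian motion, gives characteristic
functions converging to `Λ / (Λ + c² ‖ξ‖²)`. By Lévy's theorem it remains to recognize the limit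
law: it is the mixture of the Gaussian laws of `B (c² s)` over an exponential `s`, and the
substitution `s = √(q / L) exp u` turns the mixed density into a Macdonald function
(`besselIntegral_eq_besselK`, `charFun_gaussLaplace`).

The differential equation follows from two properties of `besselIntegral`: differentiation in `q`
lowers `α` by one with a sign change, and integration by parts relates three consecutive orders. -/

/-! ### Bessel-type integrals and the Macdonald function -/

/-- The integral `∫_0^∞ s ^ α exp (-L s - q / s) ds`. -/
noncomputable def besselIntegral (α L q : ℝ) : ℝ :=
  ∫ s in Set.Ioi (0 : ℝ), s ^ α * Real.exp (-L * s - q / s)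

/-- The factor `exp (-q / s)` is at most `N! (s / q) ^ N`, and `N` is taken large enough to outweigh
a negative power at the origin. With `β ≥ 1` the bound is integrable for `L > 0` and vanishes at
`0`. -/
theorem exists_rpow_mul_exp_le (α : ℝ) {q : ℝ} (hq : 0 < q) :
    ∃ β C : ℝ, 1 ≤ β ∧ ∀ L s : ℝ, 0 < s →
      s ^ α * Real.exp (-L * s - q / s) ≤ C * (s ^ β * Real.exp (-L * s)) := by
  obtain ⟨N, hN⟩ := exists_nat_ge (1 - α)
  refine ⟨α + N, N.factorial / q ^ N, by linarith, fun L s hs => ?_⟩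
  have h1 : (q / s) ^ N / N.factorial ≤ Real.exp (q / s) :=
    Real.pow_div_factorial_le_exp _ (by positivity) N
  have h2 : Real.exp (-(q / s)) ≤ N.factorial / q ^ N * s ^ N := by
    rw [Real.exp_neg, inv_le_comm₀ (Real.exp_pos _) (by positivity)]
    refine le_trans (le_of_eq ?_) h1
    rw [div_pow]
    field_simp
  rw [sub_eq_add_neg, Real.exp_add, Real.rpow_add hs, Real.rpow_natCast]
  calc s ^ α * (Real.exp (-L * s) * Real.exp (-(q / s)))
      ≤ s ^ α * (Real.exp (-L * s) * (N.factorial / q ^ N * s ^ N)) := by gcongr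
    _ = _ := by ring

theorem continuousOn_rpow_mul_exp (α L q : ℝ) :
    ContinuousOn (fun s : ℝ => s ^ α * Real.exp (-L * s - q / s)) (Set.Ioi 0) := by
  intro s hs
  have hs' : s ≠ 0 := ne_of_gt hs
  refine ContinuousAt.continuousWithinAt ?_
  exact (Real.continuousAt_rpow_const _ _ (Or.inl hs')).mul
    (Real.continuous_exp.continuousAt.comp (by fun_prop (disch := assumption)))

theorem integrableOn_rpow_mul_exp (α : ℝ) {L q : ℝ} (hL : 0 < L) (hq : 0 < q) :
    IntegrableOn (fun s : ℝ => s ^ α * Real.exp (-L * s - q / s)) (Set.Ioi 0) := by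
  obtain ⟨β, C, hβ, h⟩ := exists_rpow_mul_exp_le α hq
  have := integrableOn_rpow_mul_exp_neg_mul_rpow (s := β) (p := 1) (by linarith) one_pos hL
  simp only [Real.rpow_one] at this
  refine (this.const_mul C).mono' ((continuousOn_rpow_mul_exp α L q).aestronglyMeasurable
    measurableSet_Ioi) ?_
  filter_upwards [ae_restrict_mem measurableSet_Ioi] with s hs
  have hs' : (0 : ℝ) < s := hs
  rw [Real.norm_of_nonneg (by positivity)]
  exact h L s hs

/-- Differentiation under the integral brings down `-1 / s`. On the neighbourhood `(q / 2, ∞)` the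
derivative is dominated by its absolute value at `q / 2`. -/
theorem besselIntegral_hasDerivAt (α : ℝ) {L q : ℝ} (hL : 0 < L) (hq : 0 < q) :
    HasDerivAt (besselIntegral α L) (-besselIntegral (α - 1) L q) q := by
  have hq2 : 0 < q / 2 := by linarith
  have := (hasDerivAt_integral_of_dominated_loc_of_deriv_le
    (μ := volume.restrict (Set.Ioi (0 : ℝ)))
    (F := fun q s : ℝ => s ^ α * Real.exp (-L * s - q / s))
    (F' := fun q s : ℝ => -(s ^ (α - 1) * Real.exp (-L * s - q / s)))
    (bound := fun s => s ^ (α - 1) * Real.exp (-L * s - (q / 2) / s))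
    (s := Set.Ioi (q / 2)) (x₀ := q) (Ioi_mem_nhds (by linarith))
    (Eventually.of_forall fun x => (continuousOn_rpow_mul_exp α L x).aestronglyMeasurable
      measurableSet_Ioi)
    (integrableOn_rpow_mul_exp α hL hq)
    ((continuousOn_rpow_mul_exp (α - 1) L q).aestronglyMeasurable measurableSet_Ioi).neg
    ?_ (integrableOn_rpow_mul_exp (α - 1) hL hq2) ?_).2
  · rwa [integral_neg] at this
  · filter_upwards [ae_restrict_mem measurableSet_Ioi] with s hs x hx
    have hs' : (0 : ℝ) < s := hs
    have hx' : q / 2 ≤ x := le_of_lt hx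
    rw [norm_neg, Real.norm_of_nonneg (by positivity)]
    gcongr
  · filter_upwards [ae_restrict_mem measurableSet_Ioi] with s hs x hx
    have hs' : (0 : ℝ) < s := hs
    have h1 : HasDerivAt (fun x : ℝ => -L * s - x / s) (-(1 / s)) x := by
      simpa using ((hasDerivAt_id x).div_const s).const_sub (-L * s)
    refine (h1.exp.const_mul (s ^ α)).congr_deriv ?_
    rw [Real.rpow_sub_one hs'.ne']
    ring

theorem besselIntegral_contDiffOn (k : ℕ) {L : ℝ} (hL : 0 < L) (α : ℝ) :
    ContDiffOn ℝ k (besselIntegral α L) (Set.Ioi 0) := by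
  have hd : ∀ α, DifferentiableOn ℝ (besselIntegral α L) (Set.Ioi 0) := fun α q hq =>
    (besselIntegral_hasDerivAt α hL hq).differentiableAt.differentiableWithinAt
  induction k generalizing α with
  | zero => exact contDiffOn_zero.2 (hd α).continuousOn
  | succ k ih =>
    rw [Nat.cast_add, Nat.cast_one, contDiffOn_succ_iff_deriv_of_isOpen isOpen_Ioi]
    refine ⟨hd α, by simp, ?_⟩
    refine (ih (α - 1)).neg.congr fun q hq => ?_
    exact (besselIntegral_hasDerivAt α hL hq).deriv

/-- The derivative of `s ^ α exp (-L s - q / s)` has integral zero, because the function vanishes at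
both ends. This identity becomes the differential equation of the density. -/
theorem besselIntegral_recurrence {α L q : ℝ} (hα : α ≠ 0) (hL : 0 < L) (hq : 0 < q) :
    α * besselIntegral (α - 1) L q + q * besselIntegral (α - 1 - 1) L q
      = L * besselIntegral α L q := by
  obtain ⟨β, C, hβ, hb⟩ := exists_rpow_mul_exp_le α hq
  have i0 := (integrableOn_rpow_mul_exp α hL hq).const_mul L
  have i1 := (integrableOn_rpow_mul_exp (α - 1) hL hq).const_mul α
  have i2 := (integrableOn_rpow_mul_exp (α - 1 - 1) hL hq).const_mul q
  have key := integral_Ioi_of_hasDerivAt_of_tendsto (a := 0) (m := 0)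
    (f := fun s : ℝ => s ^ α * Real.exp (-L * s - q / s))
    (f' := fun s : ℝ => α * (s ^ (α - 1) * Real.exp (-L * s - q / s))
      + q * (s ^ (α - 1 - 1) * Real.exp (-L * s - q / s))
      - L * (s ^ α * Real.exp (-L * s - q / s))) ?_ ?_ ((i1.add i2).sub i0) ?_
  · have e := integral_sub (i1.add i2) i0
    have e' := integral_add i1 i2
    simp only [Pi.add_apply] at e
    rw [e, e', integral_const_mul, integral_const_mul, integral_const_mul] at key
    simp only [Real.zero_rpow hα, zero_mul, sub_zero] at key
    unfold besselIntegral
    linarith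
  -- For `α ≠ 0`, even negative, the conventions give the value `0` at `s = 0`, which agrees with
  -- the limit from the right.
  · rw [ContinuousWithinAt, Real.zero_rpow hα, zero_mul, ← Set.Ioi_union_left,
      nhdsWithin_union, tendsto_sup, nhdsWithin_singleton]
    refine ⟨?_, ?_⟩
    · have hlim : Tendsto (fun s : ℝ => C * (s ^ β * Real.exp (-L * s))) (𝓝[>] 0) (𝓝 0) := by
        have : ContinuousAt (fun s : ℝ => C * (s ^ β * Real.exp (-L * s))) 0 :=
          continuousAt_const.mul ((Real.continuousAt_rpow_const _ _ (Or.inr (by linarith))).mul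
            (by fun_prop))
        have h := this.tendsto
        simp only [Real.zero_rpow (by linarith : β ≠ 0), zero_mul, mul_zero] at h
        exact h.mono_left nhdsWithin_le_nhds
      refine tendsto_of_tendsto_of_tendsto_of_le_of_le' tendsto_const_nhds hlim ?_ ?_
      · filter_upwards [self_mem_nhdsWithin] with s hs
        have hs' : (0 : ℝ) < s := hs
        positivity
      · filter_upwards [self_mem_nhdsWithin] with s hs using hb L s hs
    · rw [tendsto_pure_left]
      intro s hs
      simpa [Real.zero_rpow hα] using mem_of_mem_nhds hs
  · intro s hs
    have hs' : (0 : ℝ) < s := hs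
    have h1 : HasDerivAt (fun s : ℝ => -L * s - q / s) (-L + q / s ^ 2) s := by
      have := ((hasDerivAt_id s).const_mul (-L)).sub ((hasDerivAt_inv hs'.ne').const_mul q)
      refine this.congr_deriv ?_
      ring
    refine ((Real.hasDerivAt_rpow_const (p := α) (Or.inl hs'.ne')).mul h1.exp).congr_deriv ?_
    rw [Real.rpow_sub_one hs'.ne' (α - 1), Real.rpow_sub_one hs'.ne' α]
    field_simp
    ring
  · have hlim : Tendsto (fun s : ℝ => C * (s ^ β * Real.exp (-L * s))) atTop (𝓝 0) := by
      simpa using (tendsto_rpow_mul_exp_neg_mul_atTop_nhds_zero β L hL).const_mul C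
    refine tendsto_of_tendsto_of_tendsto_of_le_of_le' tendsto_const_nhds hlim ?_ ?_
    · filter_upwards [eventually_gt_atTop 0] with s hs
      positivity
    · filter_upwards [eventually_gt_atTop 0] with s hs using hb L s hs

/-- The substitution `s = √(q / L) exp u` symmetrizes `L s + q / s` into `2 √(L q) cosh u`. Folding
the line at `u = 0` then turns `exp (-ν u)` into `2 cosh (ν u)`. -/
theorem besselIntegral_eq_besselK (ν : ℝ) {L q : ℝ} (hL : 0 < L) (hq : 0 < q) :
    besselIntegral (-ν - 1) L q
      = 2 * (q / L) ^ (-ν / 2) * besselK ν (2 * √(L * q)) := by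
  set a := √(q / L) with ha
  have ha0 : 0 < a := Real.sqrt_pos.2 (by positivity)
  set z := 2 * √(L * q) with hz
  have hLa : L * a = z / 2 := by
    rw [ha, hz, mul_div_cancel_left₀ _ two_ne_zero]
    symm
    rw [Real.sqrt_eq_iff_mul_self_eq (by positivity) (by positivity)]
    have := Real.mul_self_sqrt (by positivity : 0 ≤ q / L)
    calc L * q = L * L * (q / L) := by field_simp
      _ = L * L * (√(q / L) * √(q / L)) := by rw [this]
      _ = _ := by ring
  have hqa : q / a = z / 2 := by
    rw [← hLa]
    have : a * a = q / L := Real.mul_self_sqrt (by positivity)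
    field_simp
    field_simp at this
    linarith
  have himg : (fun u : ℝ => a * Real.exp u) '' Set.univ = Set.Ioi 0 := by
    ext s
    constructor
    · rintro ⟨u, -, rfl⟩
      exact mul_pos ha0 (Real.exp_pos u)
    · intro hs
      have hs' : (0 : ℝ) < s := hs
      refine ⟨Real.log (s / a), trivial, ?_⟩
      simp only [Real.exp_log (div_pos hs' ha0)]
      field_simp
  have hder : ∀ u ∈ (Set.univ : Set ℝ),
      HasDerivWithinAt (fun u : ℝ => a * Real.exp u) (a * Real.exp u) Set.univ u := fun u _ =>
    ((Real.hasDerivAt_exp u).const_mul a).hasDerivWithinAt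
  have hinj : Set.InjOn (fun u : ℝ => a * Real.exp u) Set.univ := fun u _ v _ h =>
    Real.exp_injective (mul_left_cancel₀ ha0.ne' h)
  have hfun : ∀ u : ℝ, |a * Real.exp u| • ((a * Real.exp u) ^ (-ν - 1)
      * Real.exp (-L * (a * Real.exp u) - q / (a * Real.exp u)))
      = a ^ (-ν) * (Real.exp (-z * Real.cosh u) * Real.exp (-ν * u)) := by
    intro u
    have h0 : 0 < a * Real.exp u := by positivity
    rw [abs_of_pos h0, smul_eq_mul, Real.rpow_sub_one h0.ne', Real.mul_rpow ha0.le (by positivity),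
      ← Real.exp_mul, ← div_div q, hqa, show -L * (a * Real.exp u) = -(L * a) * Real.exp u by ring,
      hLa, Real.cosh_eq, div_eq_mul_inv (z / 2), ← Real.exp_neg]
    rw [show -(z / 2) * Real.exp u - z / 2 * Real.exp (-u)
      = -z * ((Real.exp u + Real.exp (-u)) / 2) by ring]
    field_simp
  -- Integrability is carried back through the same substitution; the splitting of the line needs
  -- it.
  have hint : Integrable (fun u : ℝ => Real.exp (-z * Real.cosh u) * Real.exp (-ν * u)) := by
    have := integrableOn_rpow_mul_exp (-ν - 1) hL hq
    rw [← himg, integrableOn_image_iff_integrableOn_abs_deriv_smul MeasurableSet.univ hder hinj,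
      integrableOn_univ] at this
    simp only [hfun] at this
    have h2 := this.const_mul (a ^ (-ν))⁻¹
    have h0 : a ^ (-ν) ≠ 0 := (Real.rpow_pos_of_pos ha0 _).ne'
    simpa only [inv_mul_cancel_left₀ h0] using h2
  have hval : besselIntegral (-ν - 1) L q
      = a ^ (-ν) * ∫ u : ℝ, Real.exp (-z * Real.cosh u) * Real.exp (-ν * u) := by
    rw [besselIntegral, ← himg, integral_image_eq_integral_abs_deriv_smul MeasurableSet.univ hder
      hinj, setIntegral_univ]
    simp only [hfun]
    rw [integral_const_mul]
  have hsplit : ∫ u : ℝ, Real.exp (-z * Real.cosh u) * Real.exp (-ν * u) = 2 * besselK ν z := by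
    rw [← integral_add_compl (measurableSet_Ioi (a := (0 : ℝ))) hint, Set.compl_Ioi]
    have hneg := integral_comp_neg_Ioi (0 : ℝ)
      (fun u : ℝ => Real.exp (-z * Real.cosh u) * Real.exp (-ν * u))
    rw [neg_zero] at hneg
    rw [← hneg, ← integral_add hint.integrableOn hint.comp_neg.integrableOn, besselK,
      ← integral_const_mul]
    congr 1
    ext u
    rw [Real.cosh_neg, Real.cosh_eq (ν * u), neg_mul, neg_mul_neg]
    ring_nf
  rw [hval, hsplit]
  have : a ^ (-ν) = (q / L) ^ (-ν / 2) := by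
    rw [ha, Real.sqrt_eq_rpow, ← Real.rpow_mul (by positivity)]
    congr 1; ring
  rw [this]; ring

theorem gaussLaplaceDensity_eq_besselIntegral (n : ℕ) {L c : ℝ} (hL : 0 < L) (hc : 0 < c)
    {x : EuclideanSpace ℝ (Fin n)} (hx : x ≠ 0) :
    gaussLaplaceDensity n L c x = L * (4 * Real.pi * c ^ 2) ^ (-((n : ℝ) / 2))
      * besselIntegral (-((n : ℝ) / 2)) L (‖x‖ ^ 2 / (4 * c ^ 2)) := by
  have hx0 : 0 < ‖x‖ := norm_pos_iff.2 hx
  have hπ := Real.pi_pos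
  have h := besselIntegral_eq_besselK (((n : ℝ) - 2) / 2) hL
    (by positivity : 0 < ‖x‖ ^ 2 / (4 * c ^ 2))
  have e1 : -(((n : ℝ) - 2) / 2) - 1 = -((n : ℝ) / 2) := by ring
  have e2 : 2 * √(L * (‖x‖ ^ 2 / (4 * c ^ 2))) = √L / c * ‖x‖ := by
    rw [Real.sqrt_mul hL.le, show ‖x‖ ^ 2 / (4 * c ^ 2) = (‖x‖ / (2 * c)) ^ 2 by ring,
      Real.sqrt_sq (by positivity)]
    field_simp
  rw [e1, e2] at h
  rw [h, gaussLaplaceDensity]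
  set K := besselK (((n : ℝ) - 2) / 2) (√L / c * ‖x‖)
  suffices hs : (2 * Real.pi) ^ (-((n : ℝ) / 2)) * (√L / c) ^ (((n : ℝ) + 2) / 2)
      * ‖x‖ ^ (-(((n : ℝ) - 2) / 2)) = L * (4 * Real.pi * c ^ 2) ^ (-((n : ℝ) / 2))
      * (2 * (‖x‖ ^ 2 / (4 * c ^ 2) / L) ^ (-(((n : ℝ) - 2) / 2) / 2)) by
    rw [hs]; ring
  -- Both sides are positive, so it suffices to compare logarithms, which are combinations of those
  -- of `2`, `π`, `L`, `c` and `‖x‖`.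
  rw [← Real.exp_log (x := L * (4 * Real.pi * c ^ 2) ^ (-((n : ℝ) / 2))
      * (2 * (‖x‖ ^ 2 / (4 * c ^ 2) / L) ^ (-(((n : ℝ) - 2) / 2) / 2))) (by positivity),
    ← Real.exp_log (x := (2 * Real.pi) ^ (-((n : ℝ) / 2)) * (√L / c) ^ (((n : ℝ) + 2) / 2)
      * ‖x‖ ^ (-(((n : ℝ) - 2) / 2))) (by positivity)]
  congr 1
  have l4 : Real.log 4 = 2 * Real.log 2 := by
    rw [show (4 : ℝ) = 2 ^ 2 by norm_num, Real.log_pow]; norm_num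
  have hsL : √L ≠ 0 := (Real.sqrt_pos.2 hL).ne'
  rw [Real.log_mul (by positivity) (by positivity), Real.log_mul (by positivity) (by positivity),
    Real.log_mul (by positivity) (by positivity), Real.log_mul (by positivity) (by positivity),
    Real.log_mul (by positivity) (by positivity), Real.log_rpow (by positivity),
    Real.log_rpow (by positivity), Real.log_rpow (by positivity), Real.log_rpow (by positivity),
    Real.log_rpow (by positivity), Real.log_mul (by positivity) (by positivity),
    Real.log_mul (by positivity) (by positivity), Real.log_mul (by positivity) (by positivity),
    Real.log_div (by positivity) (by positivity), Real.log_div (by positivity) (by positivity),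
    Real.log_div (by positivity) (by positivity), Real.log_mul (by positivity) (by positivity),
    Real.log_sqrt hL.le, Real.log_pow, Real.log_pow, l4]
  push_cast
  ring

/-! ### Regularity and differential equation of the density -/

/-- The Laplacian of a function of the squared norm. -/
theorem laplacian_comp_norm_sq {n : ℕ} {f f' f'' : ℝ → ℝ}
    (hf : ∀ q, 0 < q → HasDerivAt f (f' q) q) (hf' : ∀ q, 0 < q → HasDerivAt f' (f'' q) q)
    (hc : ContDiffOn ℝ 2 f (Set.Ioi 0)) {x : EuclideanSpace ℝ (Fin n)} (hx : x ≠ 0) :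
    Δ (fun y : EuclideanSpace ℝ (Fin n) => f (‖y‖ ^ 2)) x
      = 4 * ‖x‖ ^ 2 * f'' (‖x‖ ^ 2) + 2 * n * f' (‖x‖ ^ 2) := by
  have hsq : ∀ y : EuclideanSpace ℝ (Fin n), y ≠ 0 → 0 < ‖y‖ ^ 2 := fun y hy =>
    pow_pos (norm_pos_iff.2 hy) 2
  have hN : ∀ y : EuclideanSpace ℝ (Fin n),
      HasFDerivAt (fun y : EuclideanSpace ℝ (Fin n) => ‖y‖ ^ 2) (2 • innerSL ℝ y) y := fun y =>
    (hasStrictFDerivAt_norm_sq y).hasFDerivAt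
  have hD : ∀ y : EuclideanSpace ℝ (Fin n), y ≠ 0 →
      HasFDerivAt (fun y : EuclideanSpace ℝ (Fin n) => f (‖y‖ ^ 2))
        (f' (‖y‖ ^ 2) • (2 • innerSL ℝ y)) y := fun y hy =>
    (hf _ (hsq y hy)).comp_hasFDerivAt y (hN y)
  have hcx : ContDiffAt ℝ 2 (fun y : EuclideanSpace ℝ (Fin n) => f (‖y‖ ^ 2)) x :=
    ContDiffAt.comp x (hc.contDiffAt (Ioi_mem_nhds (hsq x hx))) (contDiff_norm_sq ℝ).contDiffAt
  have hd : DifferentiableAt ℝ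
      (fderiv ℝ (fun y : EuclideanSpace ℝ (Fin n) => f (‖y‖ ^ 2))) x :=
    (hcx.fderiv_right (m := 1) (by norm_num)).differentiableAt one_ne_zero
  have hsecond : ∀ v : EuclideanSpace ℝ (Fin n),
      iteratedFDeriv ℝ 2 (fun y : EuclideanSpace ℝ (Fin n) => f (‖y‖ ^ 2)) x ![v, v]
        = 4 * f'' (‖x‖ ^ 2) * inner ℝ x v ^ 2 + 2 * f' (‖x‖ ^ 2) * inner ℝ v v := by
    intro v
    rw [iteratedFDeriv_two_apply]
    simp only [Matrix.cons_val_zero, Matrix.cons_val_one]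
    have h1 : fderiv ℝ (fderiv ℝ (fun y : EuclideanSpace ℝ (Fin n) => f (‖y‖ ^ 2))) x v v
        = fderiv ℝ (fun y => fderiv ℝ
          (fun y : EuclideanSpace ℝ (Fin n) => f (‖y‖ ^ 2)) y v) x v := by
      rw [fderiv_clm_apply hd (differentiableAt_const v)]
      simp
    have h2 : (fun y => fderiv ℝ (fun y : EuclideanSpace ℝ (Fin n) => f (‖y‖ ^ 2)) y v)
        =ᶠ[𝓝 x] fun y => f' (‖y‖ ^ 2) * (2 * inner ℝ y v) := by
      filter_upwards [isOpen_compl_singleton.mem_nhds hx] with y hy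
      rw [(hD y hy).fderiv]
      simp
    have h3 : HasFDerivAt (fun y : EuclideanSpace ℝ (Fin n) => (inner ℝ y v : ℝ))
        (innerSL ℝ v) x := by
      simpa only [innerSL_apply_apply, real_inner_comm] using! (innerSL ℝ v).hasFDerivAt (x := x)
    have h4 := ((hf' _ (hsq x hx)).comp_hasFDerivAt x (hN x)).mul (h3.const_mul 2)
    have h5 : fderiv ℝ (fun y : EuclideanSpace ℝ (Fin n) => f' (‖y‖ ^ 2) * (2 * inner ℝ y v)) x
        = _ := h4.fderiv
    rw [h1, h2.fderiv_eq, h5]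
    simp
    ring
  rw [InnerProductSpace.laplacian_eq_iteratedFDeriv_stdOrthonormalBasis]
  simp only [hsecond]
  -- Over an orthonormal basis, the squares of `inner ℝ x v` sum to `‖x‖ ^ 2` by Parseval, and the
  -- `inner ℝ v v` sum to `n`.
  rw [Finset.sum_add_distrib, ← Finset.mul_sum, ← Finset.mul_sum,
    OrthonormalBasis.sum_sq_inner_left]
  simp
  ring

theorem gaussLaplaceDensity_nonneg (n : ℕ) (L : ℝ) {c : ℝ} (hc : 0 < c)
    (x : EuclideanSpace ℝ (Fin n)) : 0 ≤ gaussLaplaceDensity n L c x := by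
  have hK : 0 ≤ besselK (((n : ℝ) - 2) / 2) (√L / c * ‖x‖) :=
    integral_nonneg fun u => mul_nonneg (Real.exp_pos _).le (Real.cosh_pos _).le
  have := Real.pi_pos
  unfold gaussLaplaceDensity
  positivity

theorem gaussLaplaceDensity_contDiffOn (n : ℕ) {L c : ℝ} (hL : 0 < L) (hc : 0 < c) :
    ContDiffOn ℝ 2 (gaussLaplaceDensity n L c) {0}ᶜ := by
  have h : ContDiffOn ℝ 2 (fun x : EuclideanSpace ℝ (Fin n) =>
      L * (4 * Real.pi * c ^ 2) ^ (-((n : ℝ) / 2))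
      * besselIntegral (-((n : ℝ) / 2)) L (‖x‖ ^ 2 / (4 * c ^ 2))) {0}ᶜ := by
    refine contDiffOn_const.mul ((besselIntegral_contDiffOn 2 hL _).comp
      ((contDiff_norm_sq ℝ).div_const _).contDiffOn ?_)
    intro x hx
    have : 0 < ‖x‖ := norm_pos_iff.2 hx
    exact Set.mem_Ioi.2 (by positivity)
  exact h.congr fun x hx => gaussLaplaceDensity_eq_besselIntegral n hL hc hx

/-- The density is `A * besselIntegral α L (k ‖x‖²)` with `α = -n / 2` and `4 c² k = 1`. The radial
Laplacian then produces exactly the left side of `besselIntegral_recurrence`; `n ≥ 1` ensures `α ≠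
0`. -/
theorem gaussLaplaceDensity_laplacian {n : ℕ} (hn : 1 ≤ n) {L c : ℝ} (hL : 0 < L) (hc : 0 < c)
    {x : EuclideanSpace ℝ (Fin n)} (hx : x ≠ 0) :
    L * gaussLaplaceDensity n L c x = c ^ 2 * Δ (gaussLaplaceDensity n L c) x := by
  set A := L * (4 * Real.pi * c ^ 2) ^ (-((n : ℝ) / 2)) with hA
  set α : ℝ := -((n : ℝ) / 2) with hα
  set k : ℝ := 1 / (4 * c ^ 2) with hk
  have hk0 : 0 < k := by positivity
  have hα0 : α ≠ 0 := by
    have : (1 : ℝ) ≤ n := by exact_mod_cast hn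
    rw [hα]; intro h; linarith
  have hx2 : 0 < ‖x‖ ^ 2 := pow_pos (norm_pos_iff.2 hx) 2
  have heq : ∀ y : EuclideanSpace ℝ (Fin n), y ≠ 0 →
      gaussLaplaceDensity n L c y = A * besselIntegral α L (k * ‖y‖ ^ 2) := fun y hy => by
    rw [gaussLaplaceDensity_eq_besselIntegral n hL hc hy, hk, one_div_mul_eq_div]
  have hev : gaussLaplaceDensity n L c
      =ᶠ[𝓝 x] fun y => (fun q => A * besselIntegral α L (k * q)) (‖y‖ ^ 2) := by
    filter_upwards [isOpen_compl_singleton.mem_nhds hx] with y hy using heq y hy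
  have hder : ∀ (β : ℝ) (q : ℝ), 0 < q → HasDerivAt (fun q => besselIntegral β L (k * q))
      (-besselIntegral (β - 1) L (k * q) * k) q := fun β q hq => by
    have h1 : HasDerivAt (fun q : ℝ => k * q) k q := by
      simpa using (hasDerivAt_id q).const_mul k
    exact (besselIntegral_hasDerivAt β hL (mul_pos hk0 hq)).comp q h1
  rw [(InnerProductSpace.laplacian_congr_nhds hev).eq_of_nhds, heq x hx,
    laplacian_comp_norm_sq (f' := fun q => A * (-besselIntegral (α - 1) L (k * q) * k))
      (f'' := fun q => A * (-(-besselIntegral (α - 1 - 1) L (k * q) * k) * k))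
      (fun q hq => (hder α q hq).const_mul A)
      (fun q hq => (((hder (α - 1) q hq).neg).mul_const k).const_mul A) ?_ hx]
  · have hrec := besselIntegral_recurrence hα0 hL (mul_pos hk0 hx2)
    have hck : c ^ 2 * (4 * k) = 1 := by rw [hk]; field_simp
    have hnα : (n : ℝ) = -2 * α := by rw [hα]; ring
    rw [hnα]
    calc L * (A * besselIntegral α L (k * ‖x‖ ^ 2))
        = A * (c ^ 2 * (4 * k)) * (L * besselIntegral α L (k * ‖x‖ ^ 2)) := by rw [hck]; ring
      _ = _ := by rw [← hrec]; ring
  · refine contDiffOn_const.mul ((besselIntegral_contDiffOn 2 hL _).comp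
      (contDiff_const.mul contDiff_id).contDiffOn fun q hq => ?_)
    exact Set.mem_Ioi.2 (mul_pos hk0 hq)

/-! ### The density as an exponential mixture of Gaussians -/

/-- The joint density of an exponential time of rate `L` and of the value at this time of a Brownian
motion with generator `c ^ 2 Δ`. -/
noncomputable def gaussMixture (n : ℕ) (L c : ℝ) (p : EuclideanSpace ℝ (Fin n) × ℝ) : ℝ :=
  L * Real.exp (-L * p.2) * ((4 * Real.pi * c ^ 2 * p.2) ^ (-((n : ℝ) / 2))
    * Real.exp (-(1 / (4 * c ^ 2 * p.2)) * ‖p.1‖ ^ 2))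

theorem measurable_gaussMixture (n : ℕ) (L c : ℝ) : Measurable (gaussMixture n L c) := by
  unfold gaussMixture
  fun_prop

theorem gaussMixture_nonneg {n : ℕ} {L c : ℝ} (hL : 0 < L) (hc : 0 < c)
    (x : EuclideanSpace ℝ (Fin n)) {s : ℝ} (hs : 0 < s) : 0 ≤ gaussMixture n L c (x, s) := by
  have := Real.pi_pos
  unfold gaussMixture
  positivity

/-- A non-integrable function has integral `0` by convention, whereas the Gaussian integral is
positive. -/
theorem integrable_exp_neg_mul_sq_norm {n : ℕ} {b : ℝ} (hb : 0 < b) :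
    Integrable (fun x : EuclideanSpace ℝ (Fin n) => Real.exp (-b * ‖x‖ ^ 2)) := by
  by_contra h
  have h1 := integral_undef h
  rw [GaussianFourier.integral_rexp_neg_mul_sq_norm hb] at h1
  have : 0 < (Real.pi / b) ^ ((Module.finrank ℝ (EuclideanSpace ℝ (Fin n)) : ℝ) / 2) := by
    have := Real.pi_pos
    positivity
  linarith

theorem integral_gaussMixture {n : ℕ} {L c : ℝ} (hc : 0 < c) {s : ℝ} (hs : 0 < s) :
    ∫ x, gaussMixture n L c (x, s) = L * Real.exp (-L * s) := by
  have hπ := Real.pi_pos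
  simp only [gaussMixture]
  rw [integral_const_mul, integral_const_mul,
    GaussianFourier.integral_rexp_neg_mul_sq_norm (by positivity), finrank_euclideanSpace_fin,
    show Real.pi / (1 / (4 * c ^ 2 * s)) = 4 * Real.pi * c ^ 2 * s by field_simp,
    ← Real.rpow_add (by positivity), neg_add_cancel, Real.rpow_zero, mul_one]

theorem integral_gaussMixture_mul_cexp {n : ℕ} {L c : ℝ} (hc : 0 < c) {s : ℝ} (hs : 0 < s)
    (ξ : EuclideanSpace ℝ (Fin n)) :
    ∫ x, (gaussMixture n L c (x, s) : ℂ) * Complex.exp ((inner ℝ x ξ : ℝ) * Complex.I)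
      = (L * Real.exp (-L * s) * Real.exp (-(c ^ 2 * ‖ξ‖ ^ 2) * s) : ℝ) := by
  have hπ := Real.pi_pos
  have h0 : 0 < 4 * Real.pi * c ^ 2 * s := by positivity
  have hb : 0 < ((1 / (4 * c ^ 2 * s) : ℝ) : ℂ).re := by
    rw [Complex.ofReal_re]; positivity
  have key := GaussianFourier.integral_cexp_neg_mul_sq_norm_add hb Complex.I ξ
  have h1 : ∀ x : EuclideanSpace ℝ (Fin n),
      (gaussMixture n L c (x, s) : ℂ) * Complex.exp ((inner ℝ x ξ : ℝ) * Complex.I)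
      = ((L * Real.exp (-L * s) * (4 * Real.pi * c ^ 2 * s) ^ (-((n : ℝ) / 2)) : ℝ) : ℂ)
        * Complex.exp (-((1 / (4 * c ^ 2 * s) : ℝ) : ℂ) * ‖x‖ ^ 2
          + Complex.I * (inner ℝ ξ x : ℝ)) := by
    intro x
    rw [Complex.exp_add, real_inner_comm, mul_comm Complex.I]
    simp only [gaussMixture]
    push_cast
    ring
  simp only [h1]
  rw [integral_const_mul, key, finrank_euclideanSpace_fin, ← Complex.ofReal_div,
    show Real.pi / (1 / (4 * c ^ 2 * s)) = 4 * Real.pi * c ^ 2 * s by field_simp,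
    show ((n : ℂ) / 2) = (((n : ℝ) / 2 : ℝ) : ℂ) by push_cast; rfl,
    ← Complex.ofReal_cpow h0.le, Complex.I_sq, ← mul_assoc, ← Complex.ofReal_mul,
    mul_assoc (L * _), ← Real.rpow_add h0, neg_add_cancel, Real.rpow_zero, mul_one]
  rw [show (-1 * (‖ξ‖ : ℂ) ^ 2 / (4 * ((1 / (4 * c ^ 2 * s) : ℝ) : ℂ)))
    = ((-(c ^ 2 * ‖ξ‖ ^ 2) * s : ℝ) : ℂ) by
      have hs' : (s : ℂ) ≠ 0 := by exact_mod_cast hs.ne'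
      have hc' : (c : ℂ) ≠ 0 := by exact_mod_cast hc.ne'
      push_cast
      field_simp]
  push_cast
  ring

theorem integrable_gaussMixture (n : ℕ) {L c : ℝ} (hL : 0 < L) (hc : 0 < c) :
    Integrable (gaussMixture n L c) (volume.prod (volume.restrict (Set.Ioi 0))) := by
  have hπ := Real.pi_pos
  rw [integrable_prod_iff' (measurable_gaussMixture n L c).aestronglyMeasurable]
  constructor
  · filter_upwards [ae_restrict_mem measurableSet_Ioi] with s hs
    have hs' : (0 : ℝ) < s := hs
    have hb : 0 < 1 / (4 * c ^ 2 * s) := by positivity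
    simp only [gaussMixture]
    exact ((integrable_exp_neg_mul_sq_norm hb).const_mul _).const_mul _
  · have h : IntegrableOn (fun s : ℝ => L * Real.exp (-L * s)) (Set.Ioi 0) :=
      (integrableOn_exp_mul_Ioi (by linarith) 0).const_mul L
    refine h.congr_fun_ae ?_
    filter_upwards [ae_restrict_mem measurableSet_Ioi] with s hs
    rw [← integral_gaussMixture (n := n) hc hs]
    refine integral_congr_ae (Eventually.of_forall fun x => ?_)
    exact (Real.norm_of_nonneg (gaussMixture_nonneg hL hc x hs)).symm

theorem gaussLaplaceDensity_eq_integral_gaussMixture {n : ℕ} {L c : ℝ} (hL : 0 < L) (hc : 0 < c)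
    {x : EuclideanSpace ℝ (Fin n)} (hx : x ≠ 0) :
    gaussLaplaceDensity n L c x = ∫ s in Set.Ioi 0, gaussMixture n L c (x, s) := by
  have hπ := Real.pi_pos
  rw [gaussLaplaceDensity_eq_besselIntegral n hL hc hx, besselIntegral, ← integral_const_mul]
  refine setIntegral_congr_fun measurableSet_Ioi fun s hs => ?_
  have hs' : (0 : ℝ) < s := hs
  simp only [gaussMixture]
  rw [Real.mul_rpow (by positivity) hs'.le, sub_eq_add_neg, Real.exp_add,
    show -(‖x‖ ^ 2 / (4 * c ^ 2) / s) = -(1 / (4 * c ^ 2 * s)) * ‖x‖ ^ 2 by field_simp]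
  ring

theorem gaussLaplaceDensity_ae_eq {n : ℕ} (hn : 1 ≤ n) {L c : ℝ} (hL : 0 < L) (hc : 0 < c) :
    gaussLaplaceDensity n L c =ᵐ[volume] fun x => ∫ s in Set.Ioi 0, gaussMixture n L c (x, s) := by
  -- In positive dimension the origin, where the mixture formula is not claimed, is a null set.
  have : Nonempty (Fin n) := ⟨⟨0, hn⟩⟩
  filter_upwards [compl_mem_ae_iff.2 (measure_singleton (0 : EuclideanSpace ℝ (Fin n)))] with x hx
  exact gaussLaplaceDensity_eq_integral_gaussMixture hL hc hx

theorem integrable_gaussLaplaceDensity {n : ℕ} (hn : 1 ≤ n) {L c : ℝ} (hL : 0 < L) (hc : 0 < c) :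
    Integrable (gaussLaplaceDensity n L c) :=
  (integrable_gaussMixture n hL hc).integral_prod_left.congr
    (gaussLaplaceDensity_ae_eq hn hL hc).symm

theorem integral_gaussLaplaceDensity {n : ℕ} (hn : 1 ≤ n) {L c : ℝ} (hL : 0 < L) (hc : 0 < c) :
    ∫ x, gaussLaplaceDensity n L c x = 1 := by
  rw [integral_congr_ae (gaussLaplaceDensity_ae_eq hn hL hc),
    integral_integral_swap (f := fun x s => gaussMixture n L c (x, s))
      (integrable_gaussMixture n hL hc),
    setIntegral_congr_fun measurableSet_Ioi fun s hs => integral_gaussMixture hc hs,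
    integral_const_mul, integral_exp_mul_Ioi (by linarith)]
  simp
  field_simp

/-- The measure on Euclidean space with the Gauss-Laplace density. -/
noncomputable def gaussLaplace (n : ℕ) (L c : ℝ) : Measure (EuclideanSpace ℝ (Fin n)) :=
  volume.withDensity fun x => ENNReal.ofReal (gaussLaplaceDensity n L c x)

theorem isProbabilityMeasure_gaussLaplace {n : ℕ} (hn : 1 ≤ n) {L c : ℝ} (hL : 0 < L)
    (hc : 0 < c) : IsProbabilityMeasure (gaussLaplace n L c) := by
  constructor
  rw [gaussLaplace, withDensity_apply _ MeasurableSet.univ, Measure.restrict_univ,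
    ← ofReal_integral_eq_lintegral_ofReal (integrable_gaussLaplaceDensity hn hL hc)
      (Eventually.of_forall (gaussLaplaceDensity_nonneg n L hc)),
    integral_gaussLaplaceDensity hn hL hc, ENNReal.ofReal_one]

/-- By Fubini, the Gaussian Fourier transform in `x` leaves the Laplace transform of the exponential
law of rate `L` at `c² ‖ξ‖²`. -/
theorem charFun_gaussLaplace {n : ℕ} (hn : 1 ≤ n) {L c : ℝ} (hL : 0 < L) (hc : 0 < c)
    (ξ : EuclideanSpace ℝ (Fin n)) :
    charFun (gaussLaplace n L c) ξ = ((L / (L + c ^ 2 * ‖ξ‖ ^ 2) : ℝ) : ℂ) := by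
  have hae := gaussLaplaceDensity_ae_eq hn hL hc
  rw [charFun_apply, gaussLaplace, integral_withDensity_eq_integral_toReal_smul₀
    (integrable_gaussLaplaceDensity hn hL hc).aestronglyMeasurable.aemeasurable.ennreal_ofReal
    (Eventually.of_forall fun x => ENNReal.ofReal_lt_top)]
  have h1 : ∫ x, (ENNReal.ofReal (gaussLaplaceDensity n L c x)).toReal
        • Complex.exp ((inner ℝ x ξ : ℝ) * Complex.I)
      = ∫ x, ∫ s in Set.Ioi 0, (gaussMixture n L c (x, s) : ℂ)
        * Complex.exp ((inner ℝ x ξ : ℝ) * Complex.I) := by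
    refine integral_congr_ae ?_
    filter_upwards [hae] with x hx
    rw [ENNReal.toReal_ofReal (gaussLaplaceDensity_nonneg n L hc x), hx, integral_mul_const,
      integral_complex_ofReal, Complex.real_smul]
  have hint : Integrable (Function.uncurry fun (x : EuclideanSpace ℝ (Fin n)) (s : ℝ) =>
      (gaussMixture n L c (x, s) : ℂ) * Complex.exp ((inner ℝ x ξ : ℝ) * Complex.I))
      (volume.prod (volume.restrict (Set.Ioi 0))) := by
    refine ((integrable_gaussMixture n hL hc).ofReal (𝕜 := ℂ)).mul_bdd (c := 1) ?_ ?_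
    · exact Measurable.aestronglyMeasurable (by fun_prop)
    · exact Eventually.of_forall fun p => (Complex.norm_exp_ofReal_mul_I _).le
  have hpos : 0 < L + c ^ 2 * ‖ξ‖ ^ 2 := by positivity
  rw [h1, integral_integral_swap hint, setIntegral_congr_fun measurableSet_Ioi
    fun s hs => integral_gaussMixture_mul_cexp hc hs ξ, integral_complex_ofReal]
  congr 1
  have h2 : ∀ s : ℝ, L * Real.exp (-L * s) * Real.exp (-(c ^ 2 * ‖ξ‖ ^ 2) * s)
      = L * Real.exp (-(L + c ^ 2 * ‖ξ‖ ^ 2) * s) := fun s => by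
    rw [mul_assoc, ← Real.exp_add]; ring_nf
  simp only [h2]
  rw [integral_const_mul, integral_exp_mul_Ioi (by linarith), mul_zero, Real.exp_zero, neg_div_neg_eq,
    mul_one_div]

/-! ### Jointly measurable evaluation of paths -/

/-- The point of the grid of mesh `1 / (k + 1)` that follows `s`. -/
noncomputable def gridPoint (k : ℕ) (s : ℝ≥0) : ℝ≥0 :=
  ((⌊((k : ℝ≥0) + 1) * s⌋₊ : ℝ≥0) + 1) / ((k : ℝ≥0) + 1)

theorem le_gridPoint (k : ℕ) (s : ℝ≥0) : s ≤ gridPoint k s := by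
  rw [gridPoint, le_div_iff₀ (by positivity), mul_comm]
  exact (Nat.lt_floor_add_one _).le

theorem gridPoint_le (k : ℕ) (s : ℝ≥0) : gridPoint k s ≤ s + 1 / ((k : ℝ≥0) + 1) := by
  rw [gridPoint, add_div]
  gcongr
  rw [div_le_iff₀ (by positivity), mul_comm]
  exact Nat.floor_le zero_le

theorem tendsto_gridPoint (s : ℝ≥0) :
    Tendsto (fun k => gridPoint k s) atTop (𝓝[≥] s) := by
  refine tendsto_nhdsWithin_iff.2 ⟨?_, Eventually.of_forall fun k => le_gridPoint k s⟩
  have h : Tendsto (fun k : ℕ => s + 1 / ((k : ℝ≥0) + 1)) atTop (𝓝 (s + 0)) :=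
    tendsto_const_nhds.add tendsto_one_div_add_atTop_nhds_zero_nat
  rw [add_zero] at h
  exact tendsto_of_tendsto_of_tendsto_of_le_of_le tendsto_const_nhds h
    (fun k => le_gridPoint k s) (fun k => gridPoint_le k s)

/-- Evaluation of a path at a time, through its values on grids; it is jointly measurable, and is the
value of the path where the path is right-continuous. -/
noncomputable def rightEval {E : Type*} [TopologicalSpace E] [Nonempty E] (x : ℝ≥0 → E)
    (s : ℝ≥0) : E :=
  limUnder atTop fun k => x (gridPoint k s)

theorem rightEval_eq {E : Type*} [TopologicalSpace E] [T2Space E] [Nonempty E] {x : ℝ≥0 → E}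
    {s : ℝ≥0} (h : ContinuousWithinAt x (Set.Ici s) s) : rightEval x s = x s :=
  (h.tendsto.comp (tendsto_gridPoint s)).limUnder_eq

/-- Plain evaluation is not measurable for the product σ-algebra on path space. On a grid the time
is encoded by a natural number, so evaluation reduces to countably many coordinates; limits then
preserve measurability. -/
theorem measurable_rightEval {E : Type*} [TopologicalSpace E] [PolishSpace E]
    [MeasurableSpace E] [BorelSpace E] [Nonempty E] :
    Measurable fun p : (ℝ≥0 → E) × ℝ≥0 => rightEval p.1 p.2 := by
  refine (StronglyMeasurable.limUnder (l := atTop) fun k => ?_).measurable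
  refine Measurable.stronglyMeasurable ?_
  have h1 : Measurable fun p : (ℝ≥0 → E) × ℕ => p.1 (((p.2 : ℝ≥0) + 1) / ((k : ℝ≥0) + 1)) :=
    measurable_from_prod_countable_left fun j => by
      dsimp only
      exact measurable_pi_apply _
  have h2 : Measurable fun p : (ℝ≥0 → E) × ℝ≥0 => (p.1, ⌊((k : ℝ≥0) + 1) * p.2⌋₊) := by
    fun_prop
  exact h1.comp h2

/-- The `r`-fold composition of the first `r` paths of a sequence. -/
noncomputable def iteratedPath (h : ℕ → ℝ≥0 → ℝ≥0) : ℕ → ℝ≥0 → ℝ≥0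
  | 0, s => s
  | r + 1, s => iteratedPath h r (rightEval (h r) s)

theorem measurable_iteratedPath (r : ℕ) :
    Measurable fun p : (ℕ → ℝ≥0 → ℝ≥0) × ℝ≥0 => iteratedPath p.1 r p.2 := by
  induction r with
  | zero => exact measurable_snd
  | succ r ih =>
    have h1 : Measurable fun p : (ℕ → ℝ≥0 → ℝ≥0) × ℝ≥0 => p.1 r :=
      (measurable_pi_apply r).comp measurable_fst
    have h2 : Measurable fun p : (ℕ → ℝ≥0 → ℝ≥0) × ℝ≥0 => rightEval (p.1 r) p.2 :=
      (measurable_rightEval (E := ℝ≥0)).comp (h1.prodMk measurable_snd)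
    exact ih.comp (measurable_fst.prodMk h2)

theorem iteratedPath_congr {h h' : ℕ → ℝ≥0 → ℝ≥0} (r : ℕ) (hh : ∀ i < r, h i = h' i) (s : ℝ≥0) :
    iteratedPath h r s = iteratedPath h' r s := by
  induction r generalizing s with
  | zero => rfl
  | succ r ih =>
    simp only [iteratedPath]
    rw [hh r (Nat.lt_succ_self r), ih fun i hi => hh i (hi.trans (Nat.lt_succ_self r))]

/-! ### Paths of subordinators and their compositions -/

/-- The properties of almost all paths of a subordinator. -/
structure IsSubordinatorPath (x : ℝ≥0 → ℝ≥0) : Prop where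
  zero : x 0 = 0
  mono : Monotone x
  rightCont : ∀ t, ContinuousWithinAt x (Set.Ici t) t

theorem IsSubordinatorPath.comp {x y : ℝ≥0 → ℝ≥0} (hx : IsSubordinatorPath x)
    (hy : IsSubordinatorPath y) : IsSubordinatorPath (fun s => x (y s)) where
  zero := by rw [hy.zero, hx.zero]
  mono := hx.mono.comp hy.mono
  rightCont t := (hx.rightCont (y t)).comp (hy.rightCont t) fun _ hs => hy.mono hs

theorem IsSubordinatorPath.iterate {h : ℕ → ℝ≥0 → ℝ≥0} (hh : ∀ i, IsSubordinatorPath (h i))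
    (r : ℕ) : IsSubordinatorPath (iteratedPath h r) := by
  induction r with
  | zero => exact ⟨rfl, monotone_id, fun t => continuousWithinAt_id⟩
  | succ r ih =>
    have : iteratedPath h (r + 1) = fun s => iteratedPath h r (h r s) := by
      ext s
      rw [iteratedPath, rightEval_eq ((hh r).rightCont s)]
    rw [this]
    exact ih.comp (hh r)

theorem iteratedProcess_eq_iteratedPath {Ω : Type*} {H : ℕ → ℝ≥0 → Ω → ℝ≥0} {ω : Ω}
    (hh : ∀ i, IsSubordinatorPath (fun t => H i t ω)) (r : ℕ) (s : ℝ≥0) :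
    iteratedProcess H r s ω = iteratedPath (fun i t => H i t ω) r s := by
  induction r generalizing s with
  | zero => rfl
  | succ r ih =>
    rw [iteratedProcess, iteratedPath, rightEval_eq ((hh r).rightCont s), ih]

theorem IsStableSubordinator.ae_isSubordinatorPath {Ω : Type*} [MeasurableSpace Ω] {P : Measure Ω}
    {ν : ℝ} {H : ℝ≥0 → Ω → ℝ≥0} (hH : IsStableSubordinator ν H P) :
    ∀ᵐ ω ∂P, IsSubordinatorPath (fun t => H t ω) := by
  filter_upwards [hH.start, hH.paths] with ω h0 h1
  exact ⟨h0, h1.1, h1.2⟩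

/-! ### Independence and Laplace transforms -/

/-- Measurable functions of two disjoint finite parts of an independent family are independent. -/
theorem ProbabilityTheory.iIndepFun.indepFun_of_dependsOn {Ω ι α β γ : Type*} [MeasurableSpace Ω]
    [MeasurableSpace α] [MeasurableSpace β] [MeasurableSpace γ] [Nonempty α] {P : Measure Ω}
    {X : ι → Ω → α} (hX : iIndepFun X P) (hm : ∀ i, Measurable (X i)) {S T : Finset ι}
    (hST : Disjoint S T) {F : (ι → α) → β} {G : (ι → α) → γ} (hF : Measurable F)
    (hG : Measurable G) (hFS : DependsOn F S) (hGT : DependsOn G T) :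
    IndepFun (fun ω => F fun i => X i ω) (fun ω => G fun i => X i ω) P := by
  classical
  obtain ⟨a⟩ := ‹Nonempty α›
  -- A family known only on `U` is completed by an arbitrary constant, which a function depending
  -- only on `U` does not see.
  let e : (U : Finset ι) → (U → α) → ι → α := fun U x i => if h : i ∈ U then x ⟨i, h⟩ else a
  have he : ∀ U, Measurable (e U) := fun U => by
    refine measurable_pi_iff.2 fun i => ?_
    by_cases h : i ∈ U
    · simp only [e, h, dif_pos]
      exact measurable_pi_apply _
    · simp only [e, h, dif_neg, not_false_eq_true]
      exact measurable_const
  have key := (hX.indepFun_finset S T hST hm).comp (hF.comp (he S)) (hG.comp (he T))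
  convert key using 1
  · ext ω
    refine hFS fun i hi => ?_
    have : i ∈ S := hi
    simp [e, this]
  · ext ω
    refine hGT fun i hi => ?_
    have : i ∈ T := hi
    simp [e, this]

/-- Substitution of an independent variable under an expectation. -/
theorem ProbabilityTheory.IndepFun.integral_comp_prodMk {Ω α β E : Type*} [MeasurableSpace Ω]
    [MeasurableSpace α] [MeasurableSpace β] [NormedAddCommGroup E] [NormedSpace ℝ E]
    {P : Measure Ω} [IsProbabilityMeasure P] {X : Ω → α} {Y : Ω → β}
    (h : IndepFun X Y P) (hX : Measurable X) (hY : Measurable Y) {f : α × β → E}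
    (hf : StronglyMeasurable f) {C : ℝ} (hC : ∀ p, ‖f p‖ ≤ C) :
    ∫ ω, f (X ω, Y ω) ∂P = ∫ ω, ∫ ω', f (X ω', Y ω) ∂P ∂P := by
  have := Measure.isProbabilityMeasure_map (μ := P) hX.aemeasurable
  have := Measure.isProbabilityMeasure_map (μ := P) hY.aemeasurable
  have h1 : ∫ ω, f (X ω, Y ω) ∂P = ∫ p, f p ∂(P.map X).prod (P.map Y) := by
    rw [← (indepFun_iff_map_prod_eq_prod_map_map hX.aemeasurable hY.aemeasurable).1 h,
      integral_map (hX.prodMk hY).aemeasurable hf.aestronglyMeasurable]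
  have hint : Integrable f ((P.map X).prod (P.map Y)) :=
    Integrable.of_bound hf.aestronglyMeasurable C (Eventually.of_forall hC)
  rw [h1, integral_prod_symm f hint, integral_map hY.aemeasurable
    hf.integral_prod_left'.aestronglyMeasurable]
  refine integral_congr_ae (Eventually.of_forall fun ω => ?_)
  exact integral_map hX.aemeasurable (hf.comp_measurable (by fun_prop)).aestronglyMeasurable

/-- The innermost value `H r s` is independent of the outer `r`-fold composition. Conditioning on it
replaces `μ` by `μ ^ (ν ^ r)`, to which the Laplace transform of `H r s` applies. -/
theorem integral_exp_iteratedPath {Ω : Type*} [MeasurableSpace Ω] {P : Measure Ω}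
    [IsProbabilityMeasure P] {ν : ℝ} {H : ℕ → ℝ≥0 → Ω → ℝ≥0}
    (hH : ∀ i, IsStableSubordinator ν (H i) P)
    (hind : iIndepFun (fun (i : ℕ) ω (t : ℝ≥0) => H i t ω) P) (r : ℕ) (s : ℝ≥0) {μ : ℝ}
    (hμ : 0 ≤ μ) :
    ∫ ω, Real.exp (-μ * iteratedPath (fun i t => H i t ω) r s) ∂P
      = Real.exp (-s * μ ^ (ν ^ r)) := by
  have hm : ∀ i, Measurable fun ω (t : ℝ≥0) => H i t ω := fun i =>
    measurable_pi_iff.2 (hH i).measurable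
  induction r generalizing s with
  | zero => simp [iteratedPath, mul_comm]
  | succ r ih =>
    -- Only the first `r` paths are kept, so that this functional depends on finitely many indices,
    -- all different from `r`.
    let trunc : (ℕ → ℝ≥0 → ℝ≥0) → ℕ → ℝ≥0 → ℝ≥0 := fun h i => if i < r then h i else 0
    have htrunc : Measurable trunc := by
      refine measurable_pi_iff.2 fun i => ?_
      by_cases hi : i < r
      · simpa only [trunc, hi, if_true] using measurable_pi_apply i
      · simpa only [trunc, hi, if_false] using measurable_const
    have hr : Measurable fun h : ℕ → ℝ≥0 → ℝ≥0 => h r := measurable_pi_apply r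
    have hG : Measurable fun h : ℕ → ℝ≥0 → ℝ≥0 => rightEval (h r) s :=
      (measurable_rightEval (E := ℝ≥0)).comp (hr.prodMk measurable_const)
    have hfam : Measurable fun ω i (t : ℝ≥0) => H i t ω := measurable_pi_iff.2 hm
    have hXY := hind.indepFun_of_dependsOn hm (S := Finset.range r) (T := {r}) (by simp)
      htrunc hG
      (fun h h' hh => by
        ext1 i
        by_cases hi : i < r
        · simp only [trunc, hi, if_true]
          exact hh i (by simpa using hi)
        · simp only [trunc, hi, if_false])
      (fun h h' hh => by
        rw [hh r (by simp)])
    have key := hXY.integral_comp_prodMk (htrunc.comp hfam) (hG.comp hfam)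
      (f := fun p : (ℕ → ℝ≥0 → ℝ≥0) × ℝ≥0 => Real.exp (-μ * iteratedPath p.1 r p.2)) (C := 1)
      ((measurable_iteratedPath r).coe_nnreal_real.const_mul (-μ)).exp.stronglyMeasurable
      (fun p => by
        rw [Real.norm_of_nonneg (Real.exp_pos _).le, Real.exp_le_one_iff, neg_mul, neg_nonpos]
        positivity)
    have hcongr : ∀ (h : ℕ → ℝ≥0 → ℝ≥0) t, iteratedPath (trunc h) r t = iteratedPath h r t :=
      fun h t => iteratedPath_congr r (fun i hi => by simp [trunc, hi]) t
    simp only [hcongr, ih] at key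
    simp only [iteratedPath]
    rw [key]
    have hae : ∀ᵐ ω ∂P, rightEval (fun t => H r t ω) s = H r s ω := by
      filter_upwards [(hH r).ae_isSubordinatorPath] with ω hω using rightEval_eq (hω.rightCont s)
    have h2 : ∫ ω, Real.exp (-((rightEval (fun t => H r t ω) s : ℝ≥0) : ℝ) * μ ^ ν ^ r) ∂P
        = ∫ ω, Real.exp (-(μ ^ ν ^ r) * (H r s ω : ℝ)) ∂P := by
      refine integral_congr_ae ?_
      filter_upwards [hae] with ω hω
      rw [hω]; ring_nf
    rw [h2, (hH r).laplace s _ (Real.rpow_nonneg hμ _), ← Real.rpow_mul hμ, pow_succ]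

/-- The linear combination of iterated compositions, as a functional of the family of paths. -/
noncomputable def combinedPath {m : ℕ} (lam ν : Fin m → ℝ) (r : ℕ)
    (h : Fin m × ℕ → ℝ≥0 → ℝ≥0) (s : ℝ≥0) : ℝ :=
  ∑ j, lam j ^ (1 / ν j ^ r) * (iteratedPath (fun i => h (j, i)) r s : ℝ)

theorem measurable_iteratedPath_family {m : ℕ} (r : ℕ) (j : Fin m) :
    Measurable fun p : (Fin m × ℕ → ℝ≥0 → ℝ≥0) × ℝ≥0 =>
      iteratedPath (fun i => p.1 (j, i)) r p.2 := by
  have h1 : Measurable fun p : (Fin m × ℕ → ℝ≥0 → ℝ≥0) × ℝ≥0 => fun i : ℕ => p.1 (j, i) :=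
    measurable_pi_iff.2 fun i => (measurable_pi_apply (j, i)).comp measurable_fst
  exact (measurable_iteratedPath r).comp (h1.prodMk measurable_snd)

theorem measurable_combinedPath {m : ℕ} (lam ν : Fin m → ℝ) (r : ℕ) :
    Measurable fun p : (Fin m × ℕ → ℝ≥0 → ℝ≥0) × ℝ≥0 => combinedPath lam ν r p.1 p.2 :=
  Finset.measurable_fun_sum _ fun j _ =>
    (measurable_iteratedPath_family r j).coe_nnreal_real.const_mul _

theorem combinedPath_zero {m : ℕ} {lam ν : Fin m → ℝ} {r : ℕ}
    {h : Fin m × ℕ → ℝ≥0 → ℝ≥0} (hh : ∀ k, IsSubordinatorPath (h k)) :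
    combinedPath lam ν r h 0 = 0 :=
  Finset.sum_eq_zero fun j _ => by
    rw [(IsSubordinatorPath.iterate (fun i => hh (j, i)) r).zero, NNReal.coe_zero, mul_zero]

theorem combinedPath_monotone {m : ℕ} {lam ν : Fin m → ℝ} (hlam : ∀ j, 0 ≤ lam j) {r : ℕ}
    {h : Fin m × ℕ → ℝ≥0 → ℝ≥0} (hh : ∀ k, IsSubordinatorPath (h k)) :
    Monotone (combinedPath lam ν r h) := fun _ _ hst =>
  Finset.sum_le_sum fun j _ => mul_le_mul_of_nonneg_left
    (NNReal.coe_le_coe.2 ((IsSubordinatorPath.iterate (fun i => hh (j, i)) r).mono hst))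
    (Real.rpow_nonneg (hlam j) _)

theorem combinedPath_rightCont {m : ℕ} {lam ν : Fin m → ℝ} {r : ℕ}
    {h : Fin m × ℕ → ℝ≥0 → ℝ≥0} (hh : ∀ k, IsSubordinatorPath (h k)) (t : ℝ≥0) :
    ContinuousWithinAt (combinedPath lam ν r h) (Set.Ici t) t := by
  unfold combinedPath
  refine tendsto_finsetSum _ fun j _ => Tendsto.const_mul _ ?_
  exact (NNReal.continuous_coe.tendsto _).comp
    ((IsSubordinatorPath.iterate (fun i => hh (j, i)) r).rightCont t)

theorem combinedProcess_eq_combinedPath {Ω : Type*} {m : ℕ} {lam ν : Fin m → ℝ}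
    {H : Fin m → ℕ → ℝ≥0 → Ω → ℝ≥0} {ω : Ω}
    (hh : ∀ k : Fin m × ℕ, IsSubordinatorPath (fun t => H k.1 k.2 t ω)) (r : ℕ) (s : ℝ≥0) :
    combinedProcess lam ν H r s ω = combinedPath lam ν r (fun k t => H k.1 k.2 t ω) s := by
  unfold combinedProcess combinedPath
  refine Finset.sum_congr rfl fun j _ => ?_
  rw [iteratedProcess_eq_iteratedPath (fun i => hh (j, i))]

/-- The time during which a combined path stays below the level `t`. -/
noncomputable def sojournTime {m : ℕ} (lam ν : Fin m → ℝ) (r : ℕ) (t : ℝ)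
    (h : Fin m × ℕ → ℝ≥0 → ℝ≥0) : ℝ≥0 :=
  (volume {s : ℝ | 0 < s ∧ combinedPath lam ν r h s.toNNReal < t}).toNNReal

/-- The measure of a section of a measurable set is measurable. This is why a sojourn time is used
in place of an infimum over uncountably many times. -/
theorem measurable_sojournTime {m : ℕ} (lam ν : Fin m → ℝ) (r : ℕ) (t : ℝ) :
    Measurable (sojournTime lam ν r t) := by
  have hS : MeasurableSet {p : (Fin m × ℕ → ℝ≥0 → ℝ≥0) × ℝ |
      0 < p.2 ∧ combinedPath lam ν r p.1 p.2.toNNReal < t} := by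
    have h1 : Measurable fun p : (Fin m × ℕ → ℝ≥0 → ℝ≥0) × ℝ =>
        combinedPath lam ν r p.1 p.2.toNNReal :=
      (measurable_combinedPath lam ν r).comp (measurable_fst.prodMk measurable_snd.real_toNNReal)
    have h2 : MeasurableSet {p : (Fin m × ℕ → ℝ≥0 → ℝ≥0) × ℝ |
        combinedPath lam ν r p.1 p.2.toNNReal < t} := measurableSet_lt h1 measurable_const
    exact (measurableSet_lt measurable_const measurable_snd).inter h2
  exact (measurable_measure_prodMk_left hS).ennreal_toNNReal

/-- A right-continuous nondecreasing path is below a level exactly before it reaches it. -/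
theorem lt_sInf_iff_of_monotone {X : ℝ≥0 → ℝ} (hX : Monotone X)
    (hc : ∀ t, ContinuousWithinAt X (Set.Ici t) t) {t : ℝ} (h0 : X 0 < t) (ht : ∃ s, t ≤ X s)
    (s : ℝ≥0) : s < sInf {u : ℝ≥0 | 0 < u ∧ t ≤ X u} ↔ X s < t := by
  constructor
  · intro hs
    by_contra! hst
    have hs0 : 0 < s := by
      rw [pos_iff_ne_zero]
      rintro rfl
      exact absurd hst (not_le.2 h0)
    exact absurd (csInf_le (OrderBot.bddBelow _)
      (show s ∈ {u : ℝ≥0 | 0 < u ∧ t ≤ X u} from ⟨hs0, hst⟩)) (not_le.2 hs)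
  · intro hs
    -- By right continuity the path is still below the level at some `u > s`, so the infimum is at
    -- least `u`.
    have h1 : ∀ᶠ u in 𝓝[>] s, X u < t :=
      ((hc s).mono Set.Ioi_subset_Ici_self).eventually_lt_const hs
    obtain ⟨u, hu, hsu⟩ := (h1.and self_mem_nhdsWithin).exists
    refine lt_of_lt_of_le hsu (le_csInf ?_ ?_)
    · obtain ⟨v, hv⟩ := ht
      refine ⟨v, ?_, hv⟩
      rw [pos_iff_ne_zero]
      rintro rfl
      exact absurd hv (not_le.2 h0)
    · rintro v ⟨-, hv⟩
      by_contra! hvu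
      exact absurd (hX hvu.le) (not_le.2 (hu.trans_le hv))

/-- By monotonicity the times below the level form an interval starting at `0`, whose length is the
hitting time. If the level were never reached, both times would be `0` by convention and the
equivalence would fail. -/
theorem lt_sojournTime_iff {m : ℕ} {lam ν : Fin m → ℝ} (hlam : ∀ j, 0 ≤ lam j) {r : ℕ}
    {h : Fin m × ℕ → ℝ≥0 → ℝ≥0} (hh : ∀ k, IsSubordinatorPath (h k)) {t : ℝ} (ht : 0 < t)
    (hex : ∃ s, t ≤ combinedPath lam ν r h s) :
    sojournTime lam ν r t h = sInf {u : ℝ≥0 | 0 < u ∧ t ≤ combinedPath lam ν r h u} ∧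
    ∀ s, s < sojournTime lam ν r t h ↔ combinedPath lam ν r h s < t := by
  have key := lt_sInf_iff_of_monotone (combinedPath_monotone hlam hh (ν := ν) (r := r))
    (combinedPath_rightCont hh) (by rwa [combinedPath_zero hh]) hex
  have heq : sojournTime lam ν r t h
      = sInf {u : ℝ≥0 | 0 < u ∧ t ≤ combinedPath lam ν r h u} := by
    set l := sInf {u : ℝ≥0 | 0 < u ∧ t ≤ combinedPath lam ν r h u}
    have : {s : ℝ | 0 < s ∧ combinedPath lam ν r h s.toNNReal < t} = Set.Ioo 0 (l : ℝ) := by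
      ext s
      rw [Set.mem_ofPred_eq, ← key, Set.mem_Ioo]
      refine and_congr_right fun hs => ?_
      rw [← NNReal.coe_lt_coe, Real.coe_toNNReal _ hs.le]
    rw [sojournTime, this, Real.volume_Ioo, sub_zero, ENNReal.ofReal_coe_nnreal,
      ENNReal.toNNReal_coe]
  exact ⟨heq, fun s => by rw [heq]; exact key s⟩

/-- The weights satisfy `(μ λ_j ^ (1 / ν_j ^ r)) ^ (ν_j ^ r) = λ_j μ ^ (ν_j ^ r)`. The summands use
disjoint finite blocks of the independent family, so the transforms multiply. -/
theorem integral_exp_combinedPath {Ω : Type*} [MeasurableSpace Ω] {P : Measure Ω}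
    [IsProbabilityMeasure P] {m : ℕ} {ν lam : Fin m → ℝ} (hν : ∀ j, 0 < ν j)
    (hlam : ∀ j, 0 ≤ lam j) {H : Fin m → ℕ → ℝ≥0 → Ω → ℝ≥0}
    (hH : ∀ j i, IsStableSubordinator (ν j) (H j i) P)
    (hind : iIndepFun (fun (k : Fin m × ℕ) ω (t : ℝ≥0) => H k.1 k.2 t ω) P)
    (r : ℕ) (s : ℝ≥0) {μ : ℝ} (hμ : 0 ≤ μ) :
    ∫ ω, Real.exp (-μ * combinedPath lam ν r (fun k t => H k.1 k.2 t ω) s) ∂P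
      = Real.exp (-s * ∑ j, lam j * μ ^ (ν j ^ r)) := by
  have hm : ∀ k : Fin m × ℕ, Measurable fun ω (t : ℝ≥0) => H k.1 k.2 t ω := fun k =>
    measurable_pi_iff.2 (hH k.1 k.2).measurable
  have hfam : Measurable fun ω (k : Fin m × ℕ) (t : ℝ≥0) => H k.1 k.2 t ω := measurable_pi_iff.2 hm
  let F : Fin m → (Fin m × ℕ → ℝ≥0 → ℝ≥0) → ℝ := fun j h =>
    Real.exp (-μ * (lam j ^ (1 / ν j ^ r) * (iteratedPath (fun i => h (j, i)) r s : ℝ)))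
  have hF : ∀ j, Measurable (F j) := fun j => by
    have h1 : Measurable fun h : Fin m × ℕ → ℝ≥0 → ℝ≥0 =>
        iteratedPath (fun i => h (j, i)) r s :=
      (measurable_iteratedPath_family r j).comp (measurable_id.prodMk measurable_const)
    exact ((h1.coe_nnreal_real.const_mul _).const_mul _).exp
  have hdep : ∀ j, DependsOn (F j) (({j} ×ˢ Finset.range r : Finset (Fin m × ℕ)) : Set _) :=
    fun j h h' hh => by
      simp only [F]
      rw [iteratedPath_congr (h' := fun i => h' (j, i)) r fun i hi => hh (j, i) (by simp [hi])]
  have hone : ∀ j, ∫ ω, F j (fun k t => H k.1 k.2 t ω) ∂P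
      = Real.exp (-s * (lam j * μ ^ (ν j ^ r))) := fun j => by
    have hp : 0 < ν j ^ r := pow_pos (hν j) r
    have := integral_exp_iteratedPath (hH j)
      (hind.precomp (g := fun i : ℕ => (j, i)) fun a b h => (Prod.ext_iff.1 h).2) r s
      (mul_nonneg hμ (Real.rpow_nonneg (hlam j) (1 / ν j ^ r)))
    rw [Real.mul_rpow hμ (Real.rpow_nonneg (hlam j) _), ← Real.rpow_mul (hlam j),
      one_div_mul_cancel hp.ne', Real.rpow_one, mul_comm (μ ^ _)] at this
    rw [← this]
    simp only [F]
    congr 1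
    ext ω
    ring_nf
  have hprod : ∀ S : Finset (Fin m), ∫ ω, ∏ j ∈ S, F j (fun k t => H k.1 k.2 t ω) ∂P
      = ∏ j ∈ S, Real.exp (-s * (lam j * μ ^ (ν j ^ r))) := by
    intro S
    induction S using Finset.induction_on with
    | empty => simp
    | insert j S hj ih =>
      simp only [Finset.prod_insert hj]
      have hi := hind.indepFun_of_dependsOn hm (S := {j} ×ˢ Finset.range r)
        (T := S ×ˢ Finset.range r)
        (Finset.disjoint_product.2 (Or.inl (Finset.disjoint_singleton_left.2 hj)))
        (hF j) (Finset.measurable_fun_prod S fun i _ => hF i) (hdep j)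
        (fun h h' hh => Finset.prod_congr rfl fun i hi => hdep i fun k hk => hh k (by
          simp only [Finset.coe_product, Finset.coe_singleton, Set.mem_prod,
            Set.mem_singleton_iff, Finset.mem_coe] at hk ⊢
          exact ⟨hk.1 ▸ hi, hk.2⟩))
      have h2 := hi.integral_fun_mul_eq_mul_integral
        ((hF j).comp hfam).aestronglyMeasurable
        ((Finset.measurable_fun_prod S fun i _ => hF i).comp hfam).aestronglyMeasurable
      rw [h2, hone, ih]
  have h3 := hprod Finset.univ
  rw [← Real.exp_sum, ← Finset.mul_sum] at h3
  rw [← h3]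
  congr 1
  ext ω
  simp only [F]
  rw [← Real.exp_sum, ← Finset.mul_sum, combinedPath]

/-! ### Tails and Laplace transforms -/

theorem integrable_exp_neg_mul {Ω : Type*} [MeasurableSpace Ω] {P : Measure Ω}
    [IsFiniteMeasure P] {X : Ω → ℝ} (hX : Measurable X) (h0 : ∀ ω, 0 ≤ X ω) {μ : ℝ}
    (hμ : 0 ≤ μ) : Integrable (fun ω => Real.exp (-μ * X ω)) P := by
  refine Integrable.of_bound (hX.const_mul _).exp.aestronglyMeasurable 1
    (Eventually.of_forall fun ω => ?_)
  rw [Real.norm_of_nonneg (Real.exp_pos _).le, Real.exp_le_one_iff, neg_mul, neg_nonpos]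
  exact mul_nonneg hμ (h0 ω)

theorem measureReal_lt_le_exp_mul_integral {Ω : Type*} [MeasurableSpace Ω] {P : Measure Ω}
    [IsProbabilityMeasure P] {X : Ω → ℝ} (hX : Measurable X) (h0 : ∀ ω, 0 ≤ X ω) {μ : ℝ}
    (hμ : 0 ≤ μ) (t : ℝ) :
    P.real {ω | X ω < t} ≤ Real.exp (μ * t) * ∫ ω, Real.exp (-μ * X ω) ∂P := by
  have hs : MeasurableSet {ω | X ω < t} := measurableSet_lt hX measurable_const
  rw [← integral_indicator_one hs, ← integral_const_mul]
  refine integral_mono ((integrable_const 1).indicator hs)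
    ((integrable_exp_neg_mul hX h0 hμ).const_mul _) fun ω => ?_
  simp only [Set.indicator_apply, Set.mem_ofPred_eq, Pi.one_apply]
  rw [← Real.exp_add]
  split_ifs with h
  · rw [Real.one_le_exp_iff]
    nlinarith
  · exact (Real.exp_pos _).le

theorem integral_exp_le_measureReal_lt_add {Ω : Type*} [MeasurableSpace Ω] {P : Measure Ω}
    [IsProbabilityMeasure P] {X : Ω → ℝ} (hX : Measurable X) (h0 : ∀ ω, 0 ≤ X ω) {μ : ℝ}
    (hμ : 0 ≤ μ) (t : ℝ) :
    ∫ ω, Real.exp (-μ * X ω) ∂P ≤ P.real {ω | X ω < t} + Real.exp (-μ * t) := by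
  have hs : MeasurableSet {ω | X ω < t} := measurableSet_lt hX measurable_const
  have hi : Integrable ({ω | X ω < t}.indicator (1 : Ω → ℝ)) P := (integrable_const 1).indicator hs
  have h1 : ∫ ω, ({ω | X ω < t}.indicator (1 : Ω → ℝ) ω + Real.exp (-μ * t)) ∂P
      = P.real {ω | X ω < t} + Real.exp (-μ * t) := by
    rw [integral_add hi (integrable_const _), integral_indicator_one hs]
    simp
  rw [← h1]
  refine integral_mono (integrable_exp_neg_mul hX h0 hμ) (hi.add (integrable_const _)) fun ω => ?_
  simp only [Set.indicator_apply, Set.mem_ofPred_eq, Pi.one_apply]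
  split_ifs with h
  · have h1 : Real.exp (-μ * X ω) ≤ 1 := by
      rw [Real.exp_le_one_iff, neg_mul, neg_nonpos]
      exact mul_nonneg hμ (h0 ω)
    have := Real.exp_pos (-μ * t)
    linarith
  · rw [zero_add, Real.exp_le_exp]
    nlinarith

/-- If the Laplace transforms converge to a constant, the mass at finite distance converges to this
constant, whatever the distance. -/
theorem tendsto_measureReal_lt_of_tendsto_laplace {Ω : Type*} [MeasurableSpace Ω] {P : Measure Ω}
    [IsProbabilityMeasure P] {X : ℕ → Ω → ℝ} (hX : ∀ r, Measurable (X r))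
    (h0 : ∀ r ω, 0 ≤ X r ω) {p : ℝ}
    (hL : ∀ μ : ℝ, 0 < μ → Tendsto (fun r => ∫ ω, Real.exp (-μ * X r ω) ∂P) atTop (𝓝 p))
    {t : ℝ} (ht : 0 < t) : Tendsto (fun r => P.real {ω | X r ω < t}) atTop (𝓝 p) := by
  refine tendsto_order.2 ⟨fun a ha => ?_, fun b hb => ?_⟩
  -- For the lower bound `μ` is large, making the error `exp (-μ t)` negligible; for the upper bound
  -- below, `μ` is small, making `exp (μ t)` close to `1`.
  · have h1 : Tendsto (fun μ : ℝ => p - Real.exp (-μ * t)) atTop (𝓝 (p - 0)) := by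
      refine tendsto_const_nhds.sub (Real.tendsto_exp_atBot.comp ?_)
      exact tendsto_neg_atTop_atBot.atBot_mul_const ht
    rw [sub_zero] at h1
    obtain ⟨μ, hμa, hμ⟩ := ((h1.eventually_const_lt ha).and (eventually_gt_atTop 0)).exists
    filter_upwards [((hL μ hμ).sub_const (Real.exp (-μ * t))).eventually_const_lt hμa] with r hr
    have := integral_exp_le_measureReal_lt_add (P := P) (hX r) (h0 r) hμ.le t
    linarith
  · have h1 : Tendsto (fun μ : ℝ => Real.exp (μ * t) * p) (𝓝[>] 0) (𝓝 p) := by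
      have : ContinuousAt (fun μ : ℝ => Real.exp (μ * t) * p) 0 := by fun_prop
      simpa using this.tendsto.mono_left (nhdsWithin_le_nhds (s := Set.Ioi 0))
    obtain ⟨μ, hμb, hμ⟩ := ((h1.eventually_lt_const hb).and self_mem_nhdsWithin).exists
    have hμ' : (0 : ℝ) < μ := hμ
    filter_upwards [((hL μ hμ).const_mul (Real.exp (μ * t))).eventually_lt_const hμb] with r hr
    exact (measureReal_lt_le_exp_mul_integral (hX r) (h0 r) hμ'.le t).trans_lt hr

/-- Fubini applied to `1 - exp (-a T) = ∫_0^T a exp (-a s) ds` expresses the Laplace transform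
through the tails, whose convergence is known. -/
theorem integral_exp_neg_mul_eq_one_sub {Ω : Type*} [MeasurableSpace Ω] {P : Measure Ω}
    [IsProbabilityMeasure P] {T : Ω → ℝ≥0} (hT : Measurable T) {a : ℝ} (ha : 0 < a) :
    ∫ ω, Real.exp (-a * T ω) ∂P
      = 1 - ∫ s in Set.Ioi 0, a * Real.exp (-a * s) * P.real {ω | s.toNNReal < T ω} := by
  have hS : MeasurableSet {p : Ω × ℝ | p.2.toNNReal < T p.1} :=
    measurableSet_lt measurable_snd.real_toNNReal (hT.comp measurable_fst)
  have hSs : ∀ s : ℝ, MeasurableSet {ω | s.toNNReal < T ω} := fun s =>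
    measurableSet_lt measurable_const hT
  let f : Ω → ℝ → ℝ := fun ω s =>
    {p : Ω × ℝ | p.2.toNNReal < T p.1}.indicator (fun p => a * Real.exp (-a * p.2)) (ω, s)
  have hexp : IntegrableOn (fun s : ℝ => a * Real.exp (-a * s)) (Set.Ioi 0) :=
    (integrableOn_exp_mul_Ioi (by linarith) 0).const_mul a
  have hf : Integrable (Function.uncurry f) (P.prod (volume.restrict (Set.Ioi 0))) := by
    have h1 : Integrable (fun p : Ω × ℝ => a * Real.exp (-a * p.2))
        (P.prod (volume.restrict (Set.Ioi 0))) := hexp.comp_snd P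
    exact h1.indicator hS
  have hinner : ∀ ω, ∫ s in Set.Ioi 0, f ω s = 1 - Real.exp (-a * T ω) := by
    intro ω
    have h1 : ∫ s in Set.Ioi 0, f ω s
        = ∫ s in Set.Ioi 0, (Set.Iio (T ω : ℝ)).indicator (fun s => a * Real.exp (-a * s)) s := by
      refine setIntegral_congr_fun measurableSet_Ioi fun s hs => ?_
      have hs' : (0 : ℝ) < s := hs
      simp only [f, Set.indicator_apply, Set.mem_ofPred_eq, Set.mem_Iio]
      simp only [← NNReal.coe_lt_coe, Real.coe_toNNReal _ hs'.le]
    have hd : ∀ s ∈ Set.uIcc (0 : ℝ) (T ω),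
        HasDerivAt (fun s => -Real.exp (-a * s)) (a * Real.exp (-a * s)) s := fun s _ => by
      refine (((hasDerivAt_id s).const_mul (-a)).exp.neg).congr_deriv ?_
      simp
      ring
    rw [h1, setIntegral_indicator measurableSet_Iio, Set.Ioi_inter_Iio, ← integral_Ioc_eq_integral_Ioo,
      ← intervalIntegral.integral_of_le (T ω).coe_nonneg,
      intervalIntegral.integral_eq_sub_of_hasDerivAt hd
        (Continuous.intervalIntegrable (by fun_prop) _ _)]
    simp
    ring
  have houter : ∀ s : ℝ, ∫ ω, f ω s ∂P
      = a * Real.exp (-a * s) * P.real {ω | s.toNNReal < T ω} := by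
    intro s
    have h1 : (fun ω => f ω s)
        = {ω | s.toNNReal < T ω}.indicator fun _ => a * Real.exp (-a * s) := by
      ext ω
      simp only [f, Set.indicator_apply, Set.mem_ofPred_eq]
    rw [h1, integral_indicator_const _ (hSs s), smul_eq_mul, mul_comm]
  have hswap := integral_integral_swap hf
  simp only [hinner, houter] at hswap
  rw [← hswap, integral_sub (integrable_const _)
    (integrable_exp_neg_mul hT.coe_nnreal_real (fun ω => (T ω).coe_nonneg) ha.le)]
  simp

/-! ### Exponential limit of the hitting time -/

section Subordinator

variable {Ω : Type*} [MeasurableSpace Ω] {P : Measure Ω} {m : ℕ}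
  {ν lam : Fin m → ℝ} {H : Fin m → ℕ → ℝ≥0 → Ω → ℝ≥0}

theorem combinedPath_nonneg (hlam : ∀ j, 0 ≤ lam j) (r : ℕ) (h : Fin m × ℕ → ℝ≥0 → ℝ≥0)
    (s : ℝ≥0) : 0 ≤ combinedPath lam ν r h s :=
  Finset.sum_nonneg fun j _ => mul_nonneg (Real.rpow_nonneg (hlam j) _) (NNReal.coe_nonneg _)

theorem measurable_path_family (hH : ∀ j i, IsStableSubordinator (ν j) (H j i) P) :
    Measurable fun ω (k : Fin m × ℕ) (t : ℝ≥0) => H k.1 k.2 t ω :=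
  measurable_pi_iff.2 fun k => measurable_pi_iff.2 (hH k.1 k.2).measurable

theorem measurable_combinedPath_comp (hH : ∀ j i, IsStableSubordinator (ν j) (H j i) P)
    (r : ℕ) (s : ℝ≥0) :
    Measurable fun ω => combinedPath lam ν r (fun k t => H k.1 k.2 t ω) s :=
  (measurable_combinedPath lam ν r).comp ((measurable_path_family hH).prodMk measurable_const)

theorem measurable_sojournTime_comp (hH : ∀ j i, IsStableSubordinator (ν j) (H j i) P)
    (r : ℕ) (t : ℝ) :
    Measurable fun ω => sojournTime lam ν r t (fun k t => H k.1 k.2 t ω) :=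
  (measurable_sojournTime lam ν r t).comp (measurable_path_family hH)

theorem ae_isSubordinatorPath (hH : ∀ j i, IsStableSubordinator (ν j) (H j i) P) :
    ∀ᵐ ω ∂P, ∀ k : Fin m × ℕ, IsSubordinatorPath fun t => H k.1 k.2 t ω :=
  ae_all_iff.2 fun k => (hH k.1 k.2).ae_isSubordinatorPath

/-- The Chernoff bound at `μ = 1` shows that the path is below `t` at time `k` with probability at
most `exp (t - k Λ)`, which tends to `0`. -/
theorem ae_exists_le_combinedPath [IsProbabilityMeasure P] (hν : ∀ j, 0 < ν j) (hlam : ∀ j, 0 ≤ lam j)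
    (hsum : 0 < ∑ j, lam j) (hH : ∀ j i, IsStableSubordinator (ν j) (H j i) P)
    (hind : iIndepFun (fun (k : Fin m × ℕ) ω (t : ℝ≥0) => H k.1 k.2 t ω) P) (r : ℕ) (t : ℝ) :
    ∀ᵐ ω ∂P, ∃ s, t ≤ combinedPath lam ν r (fun k t => H k.1 k.2 t ω) s := by
  have hle : ∀ k : ℕ, P.real {ω | ¬ ∃ s, t ≤ combinedPath lam ν r (fun k t => H k.1 k.2 t ω) s}
      ≤ Real.exp (1 * t) * Real.exp (-((k : ℝ≥0) : ℝ) * ∑ j, lam j) := by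
    intro k
    have h1 := measureReal_lt_le_exp_mul_integral (P := P)
      (measurable_combinedPath_comp (lam := lam) hH r (k : ℝ≥0))
      (fun ω => combinedPath_nonneg hlam r _ _) zero_le_one t
    rw [integral_exp_combinedPath hν hlam hH hind r k zero_le_one] at h1
    simp only [Real.one_rpow, mul_one] at h1
    refine (measureReal_mono fun ω hω => ?_).trans h1
    simp only [Set.mem_ofPred_eq, not_exists, not_le] at hω ⊢
    exact hω k
  have hlim : Tendsto (fun k : ℕ => Real.exp (1 * t)
      * Real.exp (-((k : ℝ≥0) : ℝ) * ∑ j, lam j)) atTop (𝓝 (Real.exp (1 * t) * 0)) := by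
    refine Tendsto.const_mul _ (Real.tendsto_exp_atBot.comp ?_)
    refine Tendsto.atBot_mul_const hsum ?_
    simp only [NNReal.coe_natCast]
    exact tendsto_neg_atTop_atBot.comp tendsto_natCast_atTop_atTop
  rw [mul_zero] at hlim
  have h0 := ge_of_tendsto' hlim hle
  exact (measureReal_eq_zero_iff).1 (le_antisymm h0 measureReal_nonneg)

theorem hittingLevelTime_ae_eq_sojournTime [IsProbabilityMeasure P] (hν : ∀ j, 0 < ν j) (hlam : ∀ j, 0 ≤ lam j)
    (hsum : 0 < ∑ j, lam j) (hH : ∀ j i, IsStableSubordinator (ν j) (H j i) P)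
    (hind : iIndepFun (fun (k : Fin m × ℕ) ω (t : ℝ≥0) => H k.1 k.2 t ω) P) (r : ℕ) {t : ℝ}
    (ht : 0 < t) :
    hittingLevelTime (combinedProcess lam ν H r) t
      =ᵐ[P] fun ω => sojournTime lam ν r t (fun k t => H k.1 k.2 t ω) := by
  filter_upwards [ae_isSubordinatorPath hH,
    ae_exists_le_combinedPath hν hlam hsum hH hind r t] with ω h1 h2
  rw [(lt_sojournTime_iff hlam h1 ht h2).1, hittingLevelTime]
  simp only [combinedProcess_eq_combinedPath h1]

/-- Almost surely the event says that the combined path is below `t` at time `s`. Its Laplace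
exponent tends to `Λ`, since `μ ^ (ν_j ^ r) → μ ^ 0 = 1` for `μ > 0`. -/
theorem tendsto_measureReal_lt_sojournTime [IsProbabilityMeasure P] (hν : ∀ j, 0 < ν j ∧ ν j < 1)
    (hlam : ∀ j, 0 ≤ lam j) (hsum : 0 < ∑ j, lam j)
    (hH : ∀ j i, IsStableSubordinator (ν j) (H j i) P)
    (hind : iIndepFun (fun (k : Fin m × ℕ) ω (t : ℝ≥0) => H k.1 k.2 t ω) P) {t : ℝ}
    (ht : 0 < t) (s : ℝ≥0) :
    Tendsto (fun r => P.real {ω | s < sojournTime lam ν r t (fun k t => H k.1 k.2 t ω)}) atTop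
      (𝓝 (Real.exp (-s * ∑ j, lam j))) := by
  have h1 := tendsto_measureReal_lt_of_tendsto_laplace (P := P)
    (fun r => measurable_combinedPath_comp (lam := lam) hH r s)
    (fun r ω => combinedPath_nonneg hlam r _ _) (p := Real.exp (-s * ∑ j, lam j)) ?_ ht
  · refine h1.congr fun r => ?_
    refine measureReal_congr ?_
    filter_upwards [ae_isSubordinatorPath hH, ae_exists_le_combinedPath (fun j => (hν j).1) hlam
      hsum hH hind r t] with ω h1 h2
    exact propext ((lt_sojournTime_iff hlam h1 ht h2).2 s).symm
  · intro μ hμ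
    simp only [integral_exp_combinedPath (fun j => (hν j).1) hlam hH hind _ s hμ.le]
    refine (Real.continuous_exp.tendsto _).comp (Tendsto.const_mul _ ?_)
    refine tendsto_finsetSum _ fun j _ => ?_
    have h2 : Tendsto (fun r => ν j ^ r) atTop (𝓝 0) :=
      tendsto_pow_atTop_nhds_zero_of_lt_one (hν j).1.le (hν j).2
    have h3 := ((Real.continuous_const_rpow hμ.ne').tendsto 0).comp h2
    rw [Real.rpow_zero] at h3
    simpa using h3.const_mul (lam j)

/-- The time spent below a level is asymptotically exponential. -/
theorem tendsto_integral_exp_sojournTime [IsProbabilityMeasure P] (hν : ∀ j, 0 < ν j ∧ ν j < 1)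
    (hlam : ∀ j, 0 ≤ lam j) (hsum : 0 < ∑ j, lam j)
    (hH : ∀ j i, IsStableSubordinator (ν j) (H j i) P)
    (hind : iIndepFun (fun (k : Fin m × ℕ) ω (t : ℝ≥0) => H k.1 k.2 t ω) P) {t : ℝ}
    (ht : 0 < t) {a : ℝ} (ha : 0 ≤ a) :
    Tendsto (fun r => ∫ ω, Real.exp (-a *
        sojournTime lam ν r t (fun k t => H k.1 k.2 t ω)) ∂P) atTop
      (𝓝 ((∑ j, lam j) / (∑ j, lam j + a))) := by
  rcases ha.eq_or_lt with rfl | ha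
  · simp [div_self hsum.ne']
  set L := ∑ j, lam j
  have hlim : Tendsto (fun r => ∫ s in Set.Ioi 0, a * Real.exp (-a * s)
      * P.real {ω | s.toNNReal < sojournTime lam ν r t (fun k t => H k.1 k.2 t ω)}) atTop
      (𝓝 (∫ s in Set.Ioi 0, a * Real.exp (-a * s) * Real.exp (-s.toNNReal * L))) := by
    refine tendsto_integral_of_dominated_convergence (fun s => a * Real.exp (-a * s))
      (fun r => ?_) ((integrableOn_exp_mul_Ioi (by linarith) 0).const_mul a) (fun r => ?_) ?_
    -- Tails are monotone in `s`, hence measurable.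
    · have hanti : Antitone fun s : ℝ =>
          P.real {ω | s.toNNReal < sojournTime lam ν r t (fun k t => H k.1 k.2 t ω)} :=
        fun s s' hs => measureReal_mono fun ω (hω : _ < _) =>
          (Real.toNNReal_le_toNNReal hs).trans_lt hω
      have := hanti.measurable
      exact Measurable.aestronglyMeasurable (by fun_prop)
    · refine Eventually.of_forall fun s => ?_
      rw [Real.norm_of_nonneg (by positivity)]
      exact mul_le_of_le_one_right (by positivity) measureReal_le_one
    · exact Eventually.of_forall fun s =>
        (tendsto_measureReal_lt_sojournTime hν hlam hsum hH hind ht s.toNNReal).const_mul _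
  have hval : ∫ s in Set.Ioi 0, a * Real.exp (-a * s) * Real.exp (-s.toNNReal * L)
      = a / (L + a) := by
    have h1 : ∀ s ∈ Set.Ioi (0 : ℝ), a * Real.exp (-a * s) * Real.exp (-s.toNNReal * L)
        = a * Real.exp (-(L + a) * s) := fun s hs => by
      have hs' : (0 : ℝ) < s := hs
      rw [Real.coe_toNNReal _ hs'.le, mul_assoc, ← Real.exp_add]
      ring_nf
    rw [setIntegral_congr_fun measurableSet_Ioi h1, integral_const_mul,
      integral_exp_mul_Ioi (by linarith), mul_zero, Real.exp_zero, neg_div_neg_eq, mul_one_div]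
  rw [hval] at hlim
  have h2 := hlim.const_sub 1
  have h3 : 1 - a / (L + a) = L / (L + a) := by
    have : L + a ≠ 0 := by positivity
    field_simp
    ring
  rw [h3] at h2
  refine h2.congr fun r => ?_
  exact (integral_exp_neg_mul_eq_one_sub (measurable_sojournTime_comp hH r t) ha).symm

end Subordinator

/-! ### Brownian motion at an independent random time -/

section Brownian

variable {Ω : Type*} [MeasurableSpace Ω] {P : Measure Ω} {n : ℕ}
  {B : ℝ≥0 → Ω → EuclideanSpace ℝ (Fin n)}

theorem IsBrownianWithGeneratorLaplacian.ae_continuous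
    (hB : IsBrownianWithGeneratorLaplacian B P) : ∀ᵐ ω ∂P, Continuous fun t => B t ω := by
  filter_upwards [ae_all_iff.2 fun k => (hB.coord k).cont] with ω hω
  have h : Continuous fun t k => B t ω k := continuous_pi fun k => by
    have h1 := (hω k).mul_const √2
    have h2 : (√2 : ℝ) ≠ 0 := by positivity
    simpa only [div_mul_cancel₀ _ h2] using h1
  exact (PiLp.continuous_toLp 2 _).comp h

theorem IsBrownianWithGeneratorLaplacian.integral_cexp [IsProbabilityMeasure P]
    (hB : IsBrownianWithGeneratorLaplacian B P) (t : ℝ≥0) (ξ : EuclideanSpace ℝ (Fin n)) :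
    ∫ ω, Complex.exp ((inner ℝ (B t ω) ξ : ℝ) * Complex.I) ∂P
      = (Real.exp (-(t * ‖ξ‖ ^ 2)) : ℝ) := by
  have hmk : ∀ k, Measurable fun ω => B t ω k := fun k => by
    have := hB.measurable t
    fun_prop
  have hind : iIndepFun (fun (k : Fin n) ω => B t ω k) P :=
    hB.indep.comp (fun _ (x : ℝ≥0 → ℝ) => x t) fun _ => measurable_pi_apply t
  have hprod := hind.integral_fun_prod_comp (fun k => (hmk k).aemeasurable)
    (f := fun k (x : ℝ) => Complex.exp ((x * ξ k : ℝ) * Complex.I))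
    (fun k => Measurable.aestronglyMeasurable (by fun_prop))
  have hone : ∀ k, ∫ ω, Complex.exp ((B t ω k * ξ k : ℝ) * Complex.I) ∂P
      = Complex.exp (-(t * ξ k ^ 2 : ℝ)) := by
    intro k
    have hlaw := (hB.coord k).hasLaw_eval t
    -- The coordinate divided by `√2` has law `N(0, t)`, so its characteristic function is taken at
    -- `√2 * ξ k`.
    have h1 := charFun_gaussianReal (μ := 0) (v := t) (√2 * ξ k)
    rw [← hlaw.map_eq, charFun_apply_real,
      integral_map hlaw.aemeasurable (Measurable.aestronglyMeasurable (by fun_prop))] at h1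
    have h2 : (√2 : ℝ) ≠ 0 := by positivity
    have h3 : (√2 : ℝ) ^ 2 = 2 := Real.sq_sqrt (by norm_num)
    convert h1 using 2
    · ext ω
      congr 1
      rw [← Complex.ofReal_mul]
      congr 2
      field_simp
    · push_cast
      rw [mul_pow, show ((√2 : ℝ) : ℂ) ^ 2 = 2 by exact_mod_cast h3]
      ring
  have hsum : ∀ ω, Complex.exp ((inner ℝ (B t ω) ξ : ℝ) * Complex.I)
      = ∏ k, Complex.exp ((B t ω k * ξ k : ℝ) * Complex.I) := by
    intro ω
    rw [← Complex.exp_sum, ← Finset.sum_mul, ← Complex.ofReal_sum]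
    congr 3
    rw [PiLp.inner_apply]
    exact Finset.sum_congr rfl fun k _ => by simp [mul_comm]
  simp only [hsum]
  rw [hprod]
  simp only [hone]
  rw [← Complex.exp_sum, EuclideanSpace.norm_sq_eq, Finset.mul_sum, ← Finset.sum_neg_distrib,
    Complex.ofReal_exp]
  simp only [Real.norm_eq_abs, sq_abs]
  push_cast
  rfl

end Brownian

/-- The characteristic function of a Brownian motion with generator the Laplacian at an independent
random time. -/
theorem IsBrownianWithGeneratorLaplacian.integral_cexp_randomTime {Ω : Type*} [MeasurableSpace Ω]
    {P : Measure Ω} [IsProbabilityMeasure P] {n : ℕ} {B : ℝ≥0 → Ω → EuclideanSpace ℝ (Fin n)}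
    (hB : IsBrownianWithGeneratorLaplacian B P) {T : Ω → ℝ≥0} (hT : Measurable T)
    (hBT : IndepFun (fun ω (t : ℝ≥0) => B t ω) T P) (ξ : EuclideanSpace ℝ (Fin n)) :
    ∫ ω, Complex.exp ((inner ℝ (B (T ω) ω) ξ : ℝ) * Complex.I) ∂P
      = (∫ ω, Real.exp (-(T ω * ‖ξ‖ ^ 2)) ∂P : ℝ) := by
  have hBm : Measurable fun ω (t : ℝ≥0) => B t ω := measurable_pi_iff.2 hB.measurable
  have heval : Measurable fun p : (ℝ≥0 → EuclideanSpace ℝ (Fin n)) × ℝ≥0 => rightEval p.1 p.2 :=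
    measurable_rightEval
  have key := hBT.integral_comp_prodMk hBm hT
    (f := fun p : (ℝ≥0 → EuclideanSpace ℝ (Fin n)) × ℝ≥0 =>
      Complex.exp ((inner ℝ (rightEval p.1 p.2) ξ : ℝ) * Complex.I)) (C := 1)
    (Measurable.stronglyMeasurable (by fun_prop))
    (fun p => (Complex.norm_exp_ofReal_mul_I _).le)
  -- The exceptional null set is the same for all times, which allows the random time `T ω` to be
  -- substituted.
  have hev : ∀ᵐ ω ∂P, ∀ t, rightEval (fun t => B t ω) t = B t ω := by
    filter_upwards [hB.ae_continuous] with ω hω t using rightEval_eq hω.continuousWithinAt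
  have h1 : ∫ ω, Complex.exp ((inner ℝ (B (T ω) ω) ξ : ℝ) * Complex.I) ∂P
      = ∫ ω, Complex.exp ((inner ℝ (rightEval (fun t => B t ω) (T ω)) ξ : ℝ) * Complex.I) ∂P := by
    refine integral_congr_ae ?_
    filter_upwards [hev] with ω hω
    rw [hω]
  have h2 : ∀ t : ℝ≥0,
      ∫ ω, Complex.exp ((inner ℝ (rightEval (fun t => B t ω) t) ξ : ℝ) * Complex.I) ∂P
        = (Real.exp (-(t * ‖ξ‖ ^ 2)) : ℝ) := by
    intro t
    rw [← hB.integral_cexp t ξ]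
    refine integral_congr_ae ?_
    filter_upwards [hev] with ω hω
    rw [hω]
  rw [h1, key]
  simp only [h2]
  exact integral_complex_ofReal

theorem IsBrownianWithGeneratorLaplacian.aemeasurable_randomTime {Ω : Type*} [MeasurableSpace Ω]
    {P : Measure Ω} {n : ℕ} {B : ℝ≥0 → Ω → EuclideanSpace ℝ (Fin n)}
    (hB : IsBrownianWithGeneratorLaplacian B P) {T : Ω → ℝ≥0} (hT : Measurable T) :
    AEMeasurable (fun ω => B (T ω) ω) P := by
  have hBm : Measurable fun ω (t : ℝ≥0) => B t ω := measurable_pi_iff.2 hB.measurable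
  have heval : Measurable fun p : (ℝ≥0 → EuclideanSpace ℝ (Fin n)) × ℝ≥0 => rightEval p.1 p.2 :=
    measurable_rightEval
  refine ⟨fun ω => rightEval (fun t => B t ω) (T ω), heval.comp (hBm.prodMk hT), ?_⟩
  filter_upwards [hB.ae_continuous] with ω hω
  exact (rightEval_eq hω.continuousWithinAt).symm

/-! ### Convergence in law -/

theorem theorem3p2 {Ω : Type*} [MeasurableSpace Ω] (P : Measure Ω) [IsProbabilityMeasure P]
    (m n : ℕ) (hn : 1 ≤ n)
    (ν lam : Fin m → ℝ) (hν : ∀ j, 0 < ν j ∧ ν j < 1)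
    (hlam : ∀ j, 0 ≤ lam j) (hlam_sum : 0 < ∑ j, lam j)
    (c : ℝ) (hc : 0 < c)
    (H : Fin m → ℕ → ℝ≥0 → Ω → ℝ≥0)
    (B : ℝ≥0 → Ω → EuclideanSpace ℝ (Fin n))
    (hH : ∀ j i, IsStableSubordinator (ν j) (H j i) P)
    (hB : IsBrownianWithGeneratorLaplacian B P)
    (hH_indep : iIndepFun (fun (k : Fin m × ℕ) ω (t : ℝ≥0) => H k.1 k.2 t ω) P)
    (hBH_indep : IndepFun (fun ω (t : ℝ≥0) => B t ω)
      (fun ω (k : Fin m × ℕ) (t : ℝ≥0) => H k.1 k.2 t ω) P) :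
    (∃ μ : ProbabilityMeasure (EuclideanSpace ℝ (Fin n)),
      (μ : Measure (EuclideanSpace ℝ (Fin n))) =
        volume.withDensity
          (fun x => ENNReal.ofReal (gaussLaplaceDensity n (∑ j, lam j) c x)) ∧
      ∀ t : ℝ, 0 < t →
        TendstoInDistribution
          (fun (r : ℕ) ω =>
            B (Real.toNNReal (c ^ 2) * hittingLevelTime (combinedProcess lam ν H r) t ω) ω)
          atTop id (fun _ => P) (μ : Measure (EuclideanSpace ℝ (Fin n)))) ∧
    (∀ x, 0 ≤ gaussLaplaceDensity n (∑ j, lam j) c x) ∧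
    ContDiffOn ℝ 2 (gaussLaplaceDensity n (∑ j, lam j) c) {0}ᶜ ∧
    ∀ x : EuclideanSpace ℝ (Fin n), x ≠ 0 →
      (∑ j, lam j) * gaussLaplaceDensity n (∑ j, lam j) c x =
        c ^ 2 * Δ (gaussLaplaceDensity n (∑ j, lam j) c) x := by
  have hprob := isProbabilityMeasure_gaussLaplace hn hlam_sum hc
  refine ⟨⟨⟨gaussLaplace n (∑ j, lam j) c, hprob⟩, rfl, fun t ht => ?_⟩,
    gaussLaplaceDensity_nonneg n _ hc, gaussLaplaceDensity_contDiffOn n hlam_sum hc,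
    fun x hx => gaussLaplaceDensity_laplacian hn hlam_sum hc hx⟩
  -- Almost surely equal to the hitting time up to the factor `c²`, this is a measurable functional
  -- of the subordinators, hence independent of `B`.
  let T : ℕ → Ω → ℝ≥0 := fun r ω =>
    Real.toNNReal (c ^ 2) * sojournTime lam ν r t (fun k t => H k.1 k.2 t ω)
  have hT : ∀ r, Measurable (T r) := fun r =>
    (measurable_sojournTime_comp hH r t).const_mul _
  have hBT : ∀ r, IndepFun (fun ω (t : ℝ≥0) => B t ω) (T r) P := fun r =>
    hBH_indep.comp measurable_id ((measurable_sojournTime lam ν r t).const_mul _)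
  have hae : ∀ r, (fun ω => B (Real.toNNReal (c ^ 2)
      * hittingLevelTime (combinedProcess lam ν H r) t ω) ω) =ᵐ[P] fun ω => B (T r ω) ω := by
    intro r
    filter_upwards [hittingLevelTime_ae_eq_sojournTime (fun j => (hν j).1) hlam hlam_sum hH
      hH_indep r ht] with ω hω
    simp only [T, hω]
  have hm : ∀ r, AEMeasurable (fun ω => B (Real.toNNReal (c ^ 2)
      * hittingLevelTime (combinedProcess lam ν H r) t ω) ω) P := fun r =>
    (hB.aemeasurable_randomTime (hT r)).congr (hae r).symm
  suffices h : TendstoInDistribution (fun (r : ℕ) ω => B (Real.toNNReal (c ^ 2)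
      * hittingLevelTime (combinedProcess lam ν H r) t ω) ω) atTop id (fun _ => P)
      (gaussLaplace n (∑ j, lam j) c) from h
  refine ⟨hm, aemeasurable_id, ?_⟩
  -- By Lévy's theorem characteristic functions suffice; at `ξ` they equal the Laplace transform of
  -- the sojourn time at `c² ‖ξ‖²`.
  refine ProbabilityMeasure.tendsto_iff_tendsto_charFun.2 fun ξ => ?_
  have hlim := tendsto_integral_exp_sojournTime hν hlam hlam_sum hH hH_indep ht
    (a := c ^ 2 * ‖ξ‖ ^ 2) (by positivity)
  simp only [ProbabilityMeasure.coe_mk, Measure.map_id]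
  rw [charFun_gaussLaplace hn hlam_sum hc]
  refine ((Complex.continuous_ofReal.tendsto _).comp hlim).congr fun r => ?_
  rw [Measure.map_congr (hae r), charFun_apply,
    integral_map (hB.aemeasurable_randomTime (hT r)) (Measurable.aestronglyMeasurable (by fun_prop)),
    hB.integral_cexp_randomTime (hT r) (hBT r)]
  simp only [Function.comp_apply, T, NNReal.coe_mul, Real.coe_toNNReal _ (sq_nonneg c)]
  congr 2
  ext ω
  ring_nf
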